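/- Let $K\subset\mathbb R^2$ be a convex body (compact, convex, nonempty interior) with boundary of class $C^2$, i.e. $\partial K$ is a simple closed curve with a regular, positively oriented, periodic $C^2$ parametrization $\gamma$; let $\kappa=\det(\gamma',\gamma'')/|\gamma'|^3$ be its curvature, and let $\delta\in(0,\mathrm{Vol}_2(K))$. For $\theta\in\mathbb R$ put $\xi=(\cos\theta,\sin\theta)$ and let the water surface $H_\xi=\{x: x\cdot\xi=h(\theta)\}$ be the line for which $K\cap\{x\cdot\xi\le h(\theta)\}$ (the underwater part) has area $\delta$. Let $\Pi_\delta(K)$ be the envelope of the lines $H_\xi$, and let $\Gamma_\delta(K)$ be the locus of the centroids of the underwater parts. A chord of flotation is a chord $[\gamma(s),\gamma(t)]=K\cap H_\xi$, where $s<t$ and $\gamma([s,t])$ is the part of $\partial K$ under water, i.e. the part that the chord cuts off; $\alpha,\beta\in(0,\pi)$ denote the angles between the vector $\gamma(t)-\gamma(s)$ and $\gamma'(s)$, $\gamma'(t)$ respectively. Consider, for a chord of flotation, the equality $$\frac{\sin^3\alpha}{\kappa(s)}=\frac{\sin^3\beta}{\kappa(t)},\tag{$*$}$$ understood in $(0,\infty]$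 (a side is $\infty$ if the curvature in it is $0$). (1) If $\Pi_\delta(K)$ is homothetic to $\Gamma_\delta(K)$, then $(*)$ holds for every chord of flotation. Here "homothetic" means that some dilation $x\mapsto p+r(x-p)$, $r\ne0$, maps $\Pi_\delta(K)$ onto $\Gamma_\delta(K)$, where the ratio is compatible with the orientation of the water surfaces: $r>0$ if $\delta<\frac12\mathrm{Vol}_2(K)$ and $r<0$ if $\delta>\frac12\mathrm{Vol}_2(K)$. (2) Whether or not $\Pi_\delta(K)$ and $\Gamma_\delta(K)$ are homothetic, $(*)$ holds for every chord of flotation if and only if the affine arc length $\int_s^t\det(\gamma'(u),\gamma''(u))^{1/3}\,du$ of the boundary arc cut off from $K$ is the same for all chords of flotation. -/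

import Mathlib

open MeasureTheory

namespace Flotation

/-- The Euclidean plane. -/
abbrev Plane : Type := EuclideanSpace ℝ (Fin 2)

noncomputable section

/-- The determinant `u₁ v₂ - u₂ v₁` of two plane vectors. -/
def det (u v : Plane) : ℝ := u 0 * v 1 - u 1 * v 0

/-- A planar convex body: a compact convex set with nonempty interior. -/
structure IsConvexBody (K : Set Plane) : Prop where
  convex : Convex ℝ K
  compact : IsCompact K
  interior_nonempty : (interior K).Nonempty

/-- `γ` is a regular, positively oriented parametrization of class `C²`, with period `T`, of the
boundary of `K`, which is a simple closed curve. Positive orientation means that the interior of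
the (convex) set `K` lies on the left of every oriented tangent line. -/
structure IsC2BoundaryParam (K : Set Plane) (γ : ℝ → Plane) (T : ℝ) : Prop where
  period_pos : 0 < T
  periodic : Function.Periodic γ T
  contDiff : ContDiff ℝ 2 γ
  regular : ∀ s, deriv γ s ≠ 0
  simple : Set.InjOn γ (Set.Ico 0 T)
  range_eq : Set.range γ = frontier K
  left : ∀ s, ∀ x ∈ interior K, 0 < det (deriv γ s) (x - γ s)

/-- The oriented curvature `det(γ', γ'') / |γ'|³`. -/
def curvature (γ : ℝ → Plane) (s : ℝ) : ℝ :=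
  det (deriv γ s) (deriv (deriv γ) s) / ‖deriv γ s‖ ^ 3

/-- The affine arc length `∫ det(γ', γ'')^(1/3)` of the arc `γ([s, t])`. -/
def affineArcLength (γ : ℝ → Plane) (s t : ℝ) : ℝ :=
  ∫ u in s..t, det (deriv γ u) (deriv (deriv γ) u) ^ (1 / 3 : ℝ)

/-- The unit vector `ξ = (cos θ, sin θ)`. -/
def dir (θ : ℝ) : Plane := !₂[Real.cos θ, Real.sin θ]

/-- The underwater part of `K`: its part in the half-plane `{x | x · ξ ≤ h}`, `ξ = dir θ`. -/
def underwater (K : Set Plane) (θ h : ℝ) : Set Plane := {x ∈ K | inner ℝ x (dir θ) ≤ h}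

/-- The line `{x | x · ξ = h}`, `ξ = dir θ`, is the water surface of `K` for the direction `ξ`:
the half-plane `{x | x · ξ ≤ h}` cuts off from `K` the area `δ`. -/
def IsWaterSurface (K : Set Plane) (δ θ h : ℝ) : Prop := volume.real (underwater K θ h) = δ

/-- The envelope of the one-parameter family of curves `{x | F x θ = 0}`: the points at which
`F = 0` and `∂F/∂θ = 0` for some parameter `θ`. -/
def envelope (F : Plane → ℝ → ℝ) : Set Plane := {x | ∃ θ, F x θ = 0 ∧ HasDerivAt (F x) 0 θ}

/-- The curve of flotation `Π_δ(K)`: the envelope of the water surfaces. (For a convex body `K`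
and `0 < δ < vol K` the family `h` of levels is unique.) -/
def flotationCurve (K : Set Plane) (δ : ℝ) : Set Plane :=
  {x | ∃ h : ℝ → ℝ, (∀ θ, IsWaterSurface K δ θ (h θ)) ∧
    x ∈ envelope (fun y θ => inner ℝ y (dir θ) - h θ)}

/-- The curve of buoyancy `Γ_δ(K)`: the locus of the centroids of the underwater parts. -/
def buoyancyCurve (K : Set Plane) (δ : ℝ) : Set Plane :=
  {x | ∃ θ h, IsWaterSurface K δ θ h ∧ x = ⨍ y in underwater K θ h, y}

/-- The dilation with some center and with ratio `r` maps `A` onto `B`. -/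
def HomotheticWithRatio (A B : Set Plane) (r : ℝ) : Prop :=
  ∃ p : Plane, AffineMap.homothety p r '' A = B

/-- `Π_δ(K)` is homothetic to `Γ_δ(K)`, as curves enveloped by (resp. having tangents parallel to)
the oriented water surfaces: the ratio is positive if less than half of `K` is under water, and
negative if more than half of `K` is under water. -/
def FlotationHomotheticToBuoyancy (K : Set Plane) (δ : ℝ) : Prop :=
  ∃ r : ℝ, r ≠ 0 ∧ (δ < volume.real K / 2 → 0 < r) ∧ (volume.real K / 2 < δ → r < 0) ∧
    HomotheticWithRatio (flotationCurve K δ) (buoyancyCurve K δ) r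

/-- The segment from `γ s` to `γ t` is a chord of flotation: it lies on a water surface, and the
arc `γ([s, t])` is the part of the boundary that it cuts off, i.e. the part under water. -/
def IsFlotationChord (K : Set Plane) (γ : ℝ → Plane) (T δ s t : ℝ) : Prop :=
  s < t ∧ t < s + T ∧ ∃ θ h, IsWaterSurface K δ θ h ∧
    inner ℝ (γ s) (dir θ) = h ∧ inner ℝ (γ t) (dir θ) = h ∧
    ∀ u ∈ Set.Icc s t, inner ℝ (γ u) (dir θ) ≤ h

/-- The angle between the chord from `γ s` to `γ t` and the tangent of `γ` at the parameter `u`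
(to be used for `u = s` and `u = t`). -/
def chordAngle (γ : ℝ → Plane) (s t u : ℝ) : ℝ :=
  InnerProductGeometry.angle (γ t - γ s) (deriv γ u)

/-- `sin³ α / κ(s) = sin³ β / κ(t)`, an equality in `[0, ∞]`: where the curvature vanishes,
the (positive) numerator divided by it is `∞`. -/
def ChordCondition (γ : ℝ → Plane) (s t : ℝ) : Prop :=
  ENNReal.ofReal (Real.sin (chordAngle γ s t s) ^ 3) / ENNReal.ofReal (curvature γ s) =
    ENNReal.ofReal (Real.sin (chordAngle γ s t t) ^ 3) / ENNReal.ofReal (curvature γ t)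

end

end Flotation

/-!
The water surfaces are parametrized by the angle `θ` of their normal `dir θ`; `tangDir θ` is their
direction. A line cutting off an area strictly between `0` and the area of `K` passes through the
interior of `K`, so it meets the boundary at exactly two points, and transversally
(`IsC2BoundaryParam.cross_neg`), even where the boundary contains segments. Integration in polar
coordinates with apex at the midpoint of the chord (`IsChord.setIntegral_underwater`) gives the area
and the first moment of the underwater part in terms of the parameters `s`, `t` of the ends of the
chord, and the implicit function theorem (`IsChord.exists_local`) makes `s` and `t` differentiable
functions of `θ` near each chord of constant area. Write `l` for the length of the chord, and
`X = cot α`, `Y = cot β` for the cotangents of the angles at its ends. Both ends have normal velocity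
`l / 2`.

The derivative of the affine length of the arc cut off is then
`D(t)^(1/3) l / (2 b) - D(s)^(1/3) l / (2 a)`, with `D = det(γ', γ'')` and `a`, `b` the normal
components of `γ'` at the ends. It vanishes exactly when the chord condition holds
(`IsCapChord.affine_deriv`); this gives the equivalence with constant affine length.

The envelope of the water surfaces is traced by the midpoint of the chord, which moves along the
chord with speed `ρ = (l / 4) (X + Y)`, and the centroid of the underwater part moves parallel to
the chord with speed `l³ / (12 δ)`. If the two curves are homothetic with ratio `r`, the tangents
at corresponding points are parallel wherever `ρ ≠ 0`, and a connectedness argument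
(`speed_dichotomy`) shows that either `r ρ(θ) = l(θ)³ / (12 δ)` for all `θ`, or
`r ρ(θ) = -l(θ + π)³ / (12 δ)` for all `θ`. The second case is excluded by the sign condition on `r`
(`not_forall_speed_neg`). In the first case `X + Y` is a constant multiple of `l²`; since
`l' = (l / 2) (Y - X)`, the derivative of this relation is the chord condition
(`IsCapChord.chordCondition_of_speed`).
-/

open MeasureTheory

namespace Flotation

/-! ### Plane geometry and the frame of a water surface -/

/-- The unit vector `(sin θ, -cos θ)`: it directs the line with normal `dir θ` so that the
half-plane below the line lies to its right, and `(tangDir θ, dir θ)` is a positively oriented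
orthonormal frame. -/
noncomputable def tangDir (θ : ℝ) : Plane := !₂[Real.sin θ, -Real.cos θ]

@[simp] lemma dir_zero (θ : ℝ) : dir θ 0 = Real.cos θ := rfl
@[simp] lemma dir_one (θ : ℝ) : dir θ 1 = Real.sin θ := rfl
@[simp] lemma tangDir_zero (θ : ℝ) : tangDir θ 0 = Real.sin θ := rfl
@[simp] lemma tangDir_one (θ : ℝ) : tangDir θ 1 = -Real.cos θ := rfl

lemma inner_eq (x y : Plane) : inner ℝ x y = x 0 * y 0 + x 1 * y 1 := by
  simp [PiLp.inner_apply, Fin.sum_univ_two, mul_comm]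

lemma plane_ext {x y : Plane} (h0 : x 0 = y 0) (h1 : x 1 = y 1) : x = y := by
  ext i; fin_cases i <;> assumption

lemma frame_expand (θ : ℝ) (v : Plane) :
    v = (inner ℝ v (tangDir θ)) • tangDir θ + (inner ℝ v (dir θ)) • dir θ := by
  have h := Real.sin_sq_add_cos_sq θ
  apply plane_ext
  · simp only [inner_eq, PiLp.add_apply, PiLp.smul_apply, smul_eq_mul, dir_zero, dir_one,
      tangDir_zero, tangDir_one]
    linear_combination -(v 0) * h
  · simp only [inner_eq, PiLp.add_apply, PiLp.smul_apply, smul_eq_mul, dir_zero, dir_one,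
      tangDir_zero, tangDir_one]
    linear_combination -(v 1) * h

lemma det_frame (θ : ℝ) (v w : Plane) :
    det v w = inner ℝ v (tangDir θ) * inner ℝ w (dir θ) -
      inner ℝ v (dir θ) * inner ℝ w (tangDir θ) := by
  have h := Real.sin_sq_add_cos_sq θ
  simp only [det, inner_eq, dir_zero, dir_one, tangDir_zero, tangDir_one]
  linear_combination -(v 0 * w 1 - v 1 * w 0) * h

lemma norm_sq_frame (θ : ℝ) (v : Plane) :
    ‖v‖ ^ 2 = inner ℝ v (tangDir θ) ^ 2 + inner ℝ v (dir θ) ^ 2 := by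
  have h := Real.sin_sq_add_cos_sq θ
  rw [← real_inner_self_eq_norm_sq]
  simp only [inner_eq, dir_zero, dir_one, tangDir_zero, tangDir_one]
  linear_combination -(v 0 ^ 2 + v 1 ^ 2) * h

lemma frame_ext (θ : ℝ) {x y : Plane} (h1 : inner ℝ x (tangDir θ) = inner ℝ y (tangDir θ))
    (h2 : inner ℝ x (dir θ) = inner ℝ y (dir θ)) : x = y := by
  rw [frame_expand θ x, frame_expand θ y, h1, h2]

lemma dir_add_pi (θ : ℝ) : dir (θ + Real.pi) = -dir θ := by
  apply plane_ext <;> simp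

lemma tangDir_add_pi (θ : ℝ) : tangDir (θ + Real.pi) = -tangDir θ := by
  apply plane_ext <;> simp

lemma inner_tangDir_dir (θ φ : ℝ) : inner ℝ (tangDir θ) (dir φ) = Real.sin (θ - φ) := by
  simp [inner_eq, Real.sin_sub]; ring

lemma inner_tangDir_self (θ : ℝ) : inner ℝ (tangDir θ) (tangDir θ) = (1 : ℝ) := by
  have := Real.sin_sq_add_cos_sq θ
  rw [inner_eq]; simp only [tangDir_zero, tangDir_one]; linarith

lemma inner_dir_self (θ : ℝ) : inner ℝ (dir θ) (dir θ) = (1 : ℝ) := by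
  have := Real.sin_sq_add_cos_sq θ
  rw [inner_eq]; simp only [dir_zero, dir_one]; linarith

lemma tangDir_ne_zero (θ : ℝ) : tangDir θ ≠ 0 := fun h => by
  simpa [h] using inner_tangDir_self θ

lemma dir_ne_zero (θ : ℝ) : dir θ ≠ 0 := fun h => by
  simpa [h] using inner_dir_self θ

/-! ### Convex bodies: rays from an interior point -/

section Body

variable {K : Set Plane}

/-- The point `p + r (q - p)` of a segment from an interior point `p` to a point `q` of the
body is interior. -/
lemma IsConvexBody.ray_mem_interior (hK : IsConvexBody K) {p q : Plane} (hp : p ∈ interior K)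
    (hq : q ∈ K) {r : ℝ} (h0 : 0 ≤ r) (h1 : r < 1) : p + r • (q - p) ∈ interior K := by
  have := hK.convex.combo_interior_self_mem_interior hp hq (a := 1 - r) (b := r) (by linarith) h0
    (by ring)
  convert this using 1
  module

lemma IsConvexBody.closure_interior (hK : IsConvexBody K) : closure (interior K) = K := by
  rw [hK.convex.closure_interior_eq_closure_of_nonempty_interior hK.interior_nonempty,
    hK.compact.isClosed.closure_eq]

lemma IsConvexBody.frontier_subset (hK : IsConvexBody K) : frontier K ⊆ K :=
  hK.compact.isClosed.frontier_subset

lemma IsConvexBody.exists_ray_mem_frontier (hK : IsConvexBody K) {p v : Plane}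
    (hp : p ∈ interior K) (hv : v ≠ 0) : ∃ μ : ℝ, 0 < μ ∧ p + μ • v ∈ frontier K := by
  have hcont : Continuous fun μ : ℝ => p + μ • v := by fun_prop
  have hb : Bornology.IsBounded ((fun μ : ℝ => p + μ • v) ⁻¹' K) := by
    obtain ⟨R, hR⟩ := hK.compact.isBounded.exists_norm_le
    refine (Metric.isBounded_iff_subset_closedBall 0).2 ⟨(R + ‖p‖) / ‖v‖, fun μ hμ => ?_⟩
    have h1 := hR _ hμ
    have h2 : ‖μ • v‖ ≤ ‖p + μ • v‖ + ‖p‖ := by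
      simpa using norm_sub_le (p + μ • v) p
    rw [norm_smul] at h2
    rw [mem_closedBall_zero_iff, le_div_iff₀ (norm_pos_iff.2 hv)]
    linarith
  have hc : IsCompact (Set.Ici 0 ∩ (fun μ : ℝ => p + μ • v) ⁻¹' K) :=
    Metric.isCompact_of_isClosed_isBounded
      (isClosed_Ici.inter (hK.compact.isClosed.preimage hcont)) (hb.subset Set.inter_subset_right)
  obtain ⟨μ, ⟨hμ0, hμK⟩, hmax⟩ := hc.exists_isGreatest
    ⟨0, by simp, by simpa using interior_subset hp⟩
  have key : ∀ ν : ℝ, p + ν • v ∈ interior K → ∃ ν' > ν, p + ν' • v ∈ K := by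
    intro ν hν
    have := (isOpen_interior.preimage hcont).mem_nhds hν
    obtain ⟨ε, hε, hsub⟩ := Metric.mem_nhds_iff.1 this
    refine ⟨ν + ε / 2, by linarith, interior_subset (hsub ?_)⟩
    rw [Metric.mem_ball, Real.dist_eq, add_sub_cancel_left, abs_of_pos (by linarith)]
    linarith
  refine ⟨μ, ?_, ?_⟩
  · obtain ⟨ν, hν, hνK⟩ := key 0 (by simpa using hp)
    exact hν.trans_le (hmax ⟨le_of_lt hν, hνK⟩)
  · rw [hK.compact.isClosed.frontier_eq]
    refine ⟨hμK, fun hint => ?_⟩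
    obtain ⟨ν, hν, hνK⟩ := key μ hint
    exact absurd (hmax ⟨le_trans hμ0 (le_of_lt hν), hνK⟩) (not_le.2 hν)

/-- A point on the line with normal `dir θ` through an interior point `p`, between `p` and a point `q` of
`K`, different from `q`, is interior. -/
lemma IsConvexBody.level_mem_interior (hK : IsConvexBody K) {p q x : Plane} {θ r : ℝ}
    (hp : p ∈ interior K) (hq : q ∈ K) (hqp : inner ℝ q (dir θ) = inner ℝ p (dir θ))
    (hxp : inner ℝ x (dir θ) = inner ℝ p (dir θ)) (h0 : 0 ≤ r) (h1 : r < 1)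
    (hx : inner ℝ x (tangDir θ) - inner ℝ p (tangDir θ) =
      r * (inner ℝ q (tangDir θ) - inner ℝ p (tangDir θ))) : x ∈ interior K := by
  have : x = p + r • (q - p) := by
    apply frame_ext θ
    · simp only [inner_add_left, real_inner_smul_left, inner_sub_left]; linarith
    · simp only [inner_add_left, real_inner_smul_left, inner_sub_left]; rw [hxp, hqp]; ring
  rw [this]
  exact hK.ray_mem_interior hp hq h0 h1

/-- On a line through an interior point `p`, there is only one boundary point on each side
of `p`. -/
lemma IsConvexBody.frontier_unique (hK : IsConvexBody K) {p q q' : Plane} {θ : ℝ}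
    (hp : p ∈ interior K) (hq : q ∈ frontier K) (hq' : q' ∈ frontier K)
    (hqp : inner ℝ q (dir θ) = inner ℝ p (dir θ)) (hqp' : inner ℝ q' (dir θ) = inner ℝ p (dir θ))
    (hside : 0 < inner ℝ (p - q) (tangDir θ) * inner ℝ (p - q') (tangDir θ)) : q = q' := by
  wlog h : |inner ℝ (p - q) (tangDir θ)| ≤ |inner ℝ (p - q') (tangDir θ)| generalizing q q'
  · exact (this hq' hq hqp' hqp (by linarith) (le_of_not_ge h)).symm
  by_contra hne
  apply hq.2
  set a := inner ℝ (p - q) (tangDir θ) with ha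
  set b := inner ℝ (p - q') (tangDir θ) with hb
  have hb0 : b ≠ 0 := fun h0 => by simp [h0] at hside
  have hab : a ≠ b := fun h0 => hne (frame_ext θ (by
    simp only [ha, hb, inner_sub_left] at h0; linarith) (hqp.trans hqp'.symm))
  have hr0 : 0 < a / b := by
    have : a / b = a * b / b ^ 2 := by field_simp
    rw [this]; positivity
  refine hK.level_mem_interior (θ := θ) hp (hK.frontier_subset hq') hqp' hqp hr0.le
    (r := a / b) ?_ ?_
  · have : a / b ≤ 1 := by
      rw [← abs_of_pos hr0, abs_div]
      exact div_le_one_of_le₀ h (abs_nonneg _)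
    refine lt_of_le_of_ne this fun h1 => hab ?_
    rwa [div_eq_one_iff_eq hb0] at h1
  · have : inner ℝ q (tangDir θ) - inner ℝ p (tangDir θ) = -a := by
      rw [ha, inner_sub_left]; ring
    rw [this]
    have : inner ℝ q' (tangDir θ) - inner ℝ p (tangDir θ) = -b := by
      rw [hb, inner_sub_left]; ring
    rw [this]; field_simp

end Body

/-! ### The boundary curve -/

section Curve

variable {K : Set Plane} {γ : ℝ → Plane} {T : ℝ}

lemma IsC2BoundaryParam.hasDerivAt (hγ : IsC2BoundaryParam K γ T) (u : ℝ) :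
    HasDerivAt γ (deriv γ u) u :=
  (hγ.contDiff.differentiable (by norm_num) u).hasDerivAt

lemma IsC2BoundaryParam.contDiff_deriv (hγ : IsC2BoundaryParam K γ T) :
    ContDiff ℝ 1 (deriv γ) :=
  ((contDiff_succ_iff_deriv (n := 1)).1 hγ.contDiff).2.2

lemma IsC2BoundaryParam.hasDerivAt_deriv (hγ : IsC2BoundaryParam K γ T) (u : ℝ) :
    HasDerivAt (deriv γ) (deriv (deriv γ) u) u :=
  (hγ.contDiff_deriv.differentiable (by norm_num) u).hasDerivAt

lemma IsC2BoundaryParam.continuous_deriv (hγ : IsC2BoundaryParam K γ T) :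
    Continuous (deriv γ) := hγ.contDiff_deriv.continuous

lemma IsC2BoundaryParam.continuous_deriv_deriv (hγ : IsC2BoundaryParam K γ T) :
    Continuous (deriv (deriv γ)) := hγ.contDiff_deriv.continuous_deriv (by norm_num)

lemma IsC2BoundaryParam.periodic_deriv (hγ : IsC2BoundaryParam K γ T) :
    Function.Periodic (deriv γ) T := fun u => by
  rw [← deriv_comp_add_const]
  congr 1
  ext1 x
  exact hγ.periodic x

lemma IsC2BoundaryParam.periodic_deriv_deriv (hγ : IsC2BoundaryParam K γ T) :
    Function.Periodic (deriv (deriv γ)) T := fun u => by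
  rw [← deriv_comp_add_const]
  congr 1
  ext1 x
  exact hγ.periodic_deriv x

lemma IsC2BoundaryParam.mem_frontier (hγ : IsC2BoundaryParam K γ T) (u : ℝ) :
    γ u ∈ frontier K := hγ.range_eq ▸ Set.mem_range_self u

lemma IsC2BoundaryParam.exists_shift (hγ : IsC2BoundaryParam K γ T) {u v : ℝ}
    (h : γ u = γ v) : ∃ k : ℤ, v = u + k * T := by
  have h1 : ∀ w, γ (toIcoMod hγ.period_pos 0 w) = γ w := fun w => by
    rw [toIcoMod]; exact hγ.periodic.sub_zsmul_eq _
  have hm : ∀ w, toIcoMod hγ.period_pos 0 w ∈ Set.Ico 0 T := fun w => by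
    simpa using toIcoMod_mem_Ico hγ.period_pos 0 w
  have h2 := hγ.simple (hm u) (hm v) (by rw [h1, h1, h])
  refine ⟨toIcoDiv hγ.period_pos 0 v - toIcoDiv hγ.period_pos 0 u, ?_⟩
  have e1 := toIcoMod_add_toIcoDiv_zsmul hγ.period_pos 0 u
  have e2 := toIcoMod_add_toIcoDiv_zsmul hγ.period_pos 0 v
  rw [zsmul_eq_mul] at e1 e2
  push_cast
  linarith

lemma IsC2BoundaryParam.eq_of_eq (hγ : IsC2BoundaryParam K γ T) {u v : ℝ}
    (h : γ u = γ v) (h1 : u < v + T) (h2 : v < u + T) : u = v := by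
  obtain ⟨k, hk⟩ := hγ.exists_shift h
  have hT := hγ.period_pos
  have : k = 0 := by
    have a1 : (k : ℝ) < 1 := by by_contra! hc; nlinarith
    have a2 : (-1 : ℝ) < k := by by_contra! hc; nlinarith
    have b1 : k < 1 := by exact_mod_cast a1
    have b2 : -1 < k := by exact_mod_cast a2
    omega
  simp [hk, this]

/-- The curvature of a positively oriented boundary curve is nonnegative. -/
lemma IsC2BoundaryParam.det_nonneg (hK : IsConvexBody K) (hγ : IsC2BoundaryParam K γ T) (u : ℝ) :
    0 ≤ det (deriv γ u) (deriv (deriv γ) u) := by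
  have hc : ∀ w : Plane, Continuous fun x : Plane => det w x := fun w => by
    unfold det; fun_prop
  have h1 : ∀ v w, 0 ≤ det (deriv γ v) (γ w - γ v) := by
    intro v w
    have hcl : γ w ∈ closure (interior K) := by
      rw [hK.closure_interior]; exact hK.frontier_subset (hγ.mem_frontier w)
    have hs : IsClosed {x : Plane | 0 ≤ det (deriv γ v) (x - γ v)} :=
      isClosed_le continuous_const ((hc _).comp (by fun_prop))
    exact closure_minimal (fun x hx => (hγ.left v x hx).le) hs hcl
  -- the sum of the inequalities at the ends of a short arc, divided by the squared length
  have h2 : ∀ v, v ≠ u → 0 ≤ det (slope γ u v) (slope (deriv γ) u v) := by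
    intro v hv
    have e : det (slope γ u v) (slope (deriv γ) u v) =
        ((v - u)⁻¹) ^ 2 * (det (deriv γ u) (γ v - γ u) + det (deriv γ v) (γ u - γ v)) := by
      simp only [slope_def_module, det, PiLp.smul_apply, PiLp.sub_apply, smul_eq_mul]
      ring
    rw [e]
    have := h1 u v
    have := h1 v u
    positivity
  have hlim : Filter.Tendsto (fun v => det (slope γ u v) (slope (deriv γ) u v))
      (nhdsWithin u {u}ᶜ) (nhds (det (deriv γ u) (deriv (deriv γ) u))) := by
    have a := (hasDerivAt_iff_tendsto_slope.1 (hγ.hasDerivAt u))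
    have b := (hasDerivAt_iff_tendsto_slope.1 (hγ.hasDerivAt_deriv u))
    have hcd : Continuous fun z : Plane × Plane => det z.1 z.2 := by unfold det; fun_prop
    exact (hcd.tendsto (deriv γ u, deriv (deriv γ) u)).comp (a.prodMk_nhds b)
  refine ge_of_tendsto hlim ?_
  filter_upwards [self_mem_nhdsWithin] with v hv using h2 v hv

/-- The tangent at a boundary point on a line through an interior point `p` is transversal to
the line: the curve goes down through the line at a left end, and up at a right end. -/
lemma IsC2BoundaryParam.cross_neg (hγ : IsC2BoundaryParam K γ T) {θ u : ℝ} {p : Plane}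
    (hp : p ∈ interior K) (hl : inner ℝ (γ u) (dir θ) = inner ℝ p (dir θ)) :
    inner ℝ (deriv γ u) (dir θ) * inner ℝ (p - γ u) (tangDir θ) < 0 := by
  have h := hγ.left u p hp
  rw [det_frame θ, inner_sub_left p (γ u) (dir θ), hl] at h
  linarith

lemma IsC2BoundaryParam.hasDerivAt_level (hγ : IsC2BoundaryParam K γ T) (w : Plane) (u : ℝ) :
    HasDerivAt (fun u => inner ℝ (γ u) w) (inner ℝ (deriv γ u) w) u := by
  simpa using (hγ.hasDerivAt u).inner ℝ (hasDerivAt_const u w)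

end Curve

/-! ### Chords -/

/-- The segment from `γ s` to `γ t` is a chord of direction `tangDir θ` through the interior of `K`;
the arc `γ([s, t])` is less than one turn. -/
structure IsChord (K : Set Plane) (γ : ℝ → Plane) (T θ s t : ℝ) : Prop where
  lt : s < t
  lt_add : t < s + T
  level : inner ℝ (γ s) (dir θ) = inner ℝ (γ t) (dir θ)
  pos : 0 < inner ℝ (γ t - γ s) (tangDir θ)
  mid : (1 / 2 : ℝ) • (γ s + γ t) ∈ interior K

lemma neg_of_deriv_neg {f : ℝ → ℝ} (hf : Continuous f) {s t d : ℝ}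
    (hs : f s = 0) (hd : HasDerivAt f d s) (hd0 : d < 0) (hne : ∀ u ∈ Set.Ioo s t, f u ≠ 0) :
    ∀ u ∈ Set.Ioo s t, f u < 0 := by
  intro u hu
  have h1 : ∀ᶠ v in nhdsWithin s (Set.Ioi s), slope f s v < 0 :=
    ((hasDerivAt_iff_tendsto_slope.1 hd).mono_left
      (nhdsWithin_mono _ fun v hv => ne_of_gt hv)).eventually_lt_const hd0
  obtain ⟨v, hv1, hv2⟩ := (h1.and (Ioo_mem_nhdsGT hu.1)).exists
  have hv : f v < 0 := by
    rw [slope_def_field, hs, sub_zero] at hv1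
    by_contra! hc
    exact absurd hv1 (not_lt.2 (div_nonneg hc (by linarith [hv2.1])))
  by_contra! hc
  obtain ⟨w, hw, hw0⟩ := intermediate_value_Icc hv2.2.le hf.continuousOn ⟨hv.le, hc⟩
  exact hne w ⟨hv2.1.trans_le hw.1, hw.2.trans_lt hu.2⟩ hw0

section Chord

variable {K : Set Plane} {γ : ℝ → Plane} {T : ℝ}

lemma IsChord.mid_level {θ s t : ℝ} (hc : IsChord K γ T θ s t) :
    inner ℝ ((1 / 2 : ℝ) • (γ s + γ t)) (dir θ) = inner ℝ (γ s) (dir θ) := by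
  simp only [real_inner_smul_left, inner_add_left, ← hc.level]; ring

lemma IsChord.deriv_left_neg (hγ : IsC2BoundaryParam K γ T) {θ s t : ℝ}
    (hc : IsChord K γ T θ s t) : inner ℝ (deriv γ s) (dir θ) < 0 := by
  have h := hγ.cross_neg (u := s) (θ := θ) hc.mid (by rw [hc.mid_level])
  have h2 := hc.pos
  simp only [inner_sub_left, real_inner_smul_left, inner_add_left] at h h2
  nlinarith

lemma IsChord.deriv_right_pos (hγ : IsC2BoundaryParam K γ T) {θ s t : ℝ}
    (hc : IsChord K γ T θ s t) : 0 < inner ℝ (deriv γ t) (dir θ) := by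
  have h := hγ.cross_neg (u := t) (θ := θ) hc.mid (by rw [hc.mid_level, hc.level])
  have h2 := hc.pos
  simp only [inner_sub_left, real_inner_smul_left, inner_add_left] at h h2
  nlinarith

/-- The boundary meets the line of a chord only at the ends of the chord. -/
lemma IsChord.eq_or_eq (hK : IsConvexBody K) (hγ : IsC2BoundaryParam K γ T) {θ s t u : ℝ}
    (hc : IsChord K γ T θ s t) (hu : inner ℝ (γ u) (dir θ) = inner ℝ (γ s) (dir θ)) :
    (γ u = γ s ∧ inner ℝ (deriv γ u) (dir θ) < 0) ∨
      (γ u = γ t ∧ 0 < inner ℝ (deriv γ u) (dir θ)) := by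
  have hm := hc.mid_level
  have h := hγ.cross_neg (u := u) (θ := θ) hc.mid (by rw [hm, hu])
  have h2 := hc.pos
  have e1 : inner ℝ ((1 / 2 : ℝ) • (γ s + γ t) - γ s) (tangDir θ) =
    (1 / 2 : ℝ) * inner ℝ (γ t - γ s) (tangDir θ) := by
      simp only [inner_sub_left, real_inner_smul_left, inner_add_left]; ring
  have e2 : inner ℝ ((1 / 2 : ℝ) • (γ s + γ t) - γ t) (tangDir θ) =
    -(1 / 2 : ℝ) * inner ℝ (γ t - γ s) (tangDir θ) := by
      simp only [inner_sub_left, real_inner_smul_left, inner_add_left]; ring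
  rcases lt_or_gt_of_ne (fun h0 => by simp [h0] at h :
      inner ℝ (deriv γ u) (dir θ) ≠ 0) with hneg | hpos
  · refine Or.inl ⟨hK.frontier_unique (θ := θ) hc.mid (hγ.mem_frontier u) (hγ.mem_frontier s)
      (hu.trans hm.symm) hm.symm ?_, hneg⟩
    rw [e1]
    exact mul_pos (pos_of_mul_neg_right h hneg.le) (by linarith)
  · refine Or.inr ⟨hK.frontier_unique (θ := θ) hc.mid (hγ.mem_frontier u) (hγ.mem_frontier t)
      (hu.trans hm.symm) (hc.level.symm.trans hm.symm) ?_, hpos⟩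
    rw [e2]
    exact mul_pos_of_neg_of_neg (neg_of_mul_neg_right h hpos.le) (by linarith)

lemma IsChord.arc_below (hK : IsConvexBody K) (hγ : IsC2BoundaryParam K γ T) {θ s t : ℝ}
    (hc : IsChord K γ T θ s t) :
    ∀ u ∈ Set.Ioo s t, inner ℝ (γ u) (dir θ) < inner ℝ (γ s) (dir θ) := by
  have hcont : Continuous γ := hγ.contDiff.continuous
  intro u hu
  have := neg_of_deriv_neg (f := fun u => inner ℝ (γ u) (dir θ) - inner ℝ (γ s) (dir θ))
    (s := s) (t := t) (by fun_prop) (by simp) ((hγ.hasDerivAt_level (dir θ) s).sub_const _)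
    (hc.deriv_left_neg hγ) (fun v hv h0 => ?_) u hu
  · linarith
  · have h1 := hc.lt_add
    rcases hc.eq_or_eq hK hγ (sub_eq_zero.1 h0) with ⟨h, -⟩ | ⟨h, -⟩
    · exact absurd (hγ.eq_of_eq h (by linarith [hv.2]) (by linarith [hv.1, hγ.period_pos]))
        (ne_of_gt hv.1)
    · exact absurd (hγ.eq_of_eq h (by linarith [hv.2, hγ.period_pos]) (by linarith [hv.1]))
        (ne_of_lt hv.2)

lemma IsChord.arc_above (hK : IsConvexBody K) (hγ : IsC2BoundaryParam K γ T) {θ s t : ℝ}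
    (hc : IsChord K γ T θ s t) :
    ∀ u ∈ Set.Ioo t (s + T), inner ℝ (γ s) (dir θ) < inner ℝ (γ u) (dir θ) := by
  have hcont : Continuous γ := hγ.contDiff.continuous
  intro u hu
  have := neg_of_deriv_neg (f := fun u => inner ℝ (γ s) (dir θ) - inner ℝ (γ u) (dir θ))
    (s := t) (t := s + T) (by fun_prop) (by simp [hc.level])
    ((hγ.hasDerivAt_level (dir θ) t).const_sub _)
    (by linarith [hc.deriv_right_pos hγ]) (fun v hv h0 => ?_) u hu
  · linarith
  · have h1 := hc.lt
    rcases hc.eq_or_eq hK hγ (sub_eq_zero.1 h0).symm with ⟨h, -⟩ | ⟨h, -⟩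
    · exact absurd (hγ.eq_of_eq (h.trans (hγ.periodic s).symm)
        (by linarith [hv.2, hγ.period_pos]) (by linarith [hv.1])) (ne_of_lt hv.2)
    · exact absurd (hγ.eq_of_eq h (by linarith [hv.2]) (by linarith [hv.1, hγ.period_pos]))
        (ne_of_gt hv.1)

lemma IsChord.unique (hK : IsConvexBody K) (hγ : IsC2BoundaryParam K γ T) {θ s t s' t' : ℝ}
    (hc : IsChord K γ T θ s t) (hc' : IsChord K γ T θ s' t')
    (hl : inner ℝ (γ s') (dir θ) = inner ℝ (γ s) (dir θ)) :
    ∃ k : ℤ, s' = s + k * T ∧ t' = t + k * T := by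
  have h1 : γ s' = γ s := by
    rcases hc.eq_or_eq hK hγ hl with ⟨h, -⟩ | ⟨-, h⟩
    · exact h
    · exact absurd h (hc'.deriv_left_neg hγ).not_gt
  have h2 : γ t' = γ t := by
    rcases hc.eq_or_eq hK hγ (hc'.level.symm.trans hl) with ⟨-, h⟩ | ⟨h, -⟩
    · exact absurd h (hc'.deriv_right_pos hγ).not_gt
    · exact h
  obtain ⟨k, hk⟩ := hγ.exists_shift h1.symm
  refine ⟨k, hk, hγ.eq_of_eq (h2.trans (?_ : γ t = γ (t + k * T))) ?_ ?_⟩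
  · exact (hγ.periodic.int_mul k t).symm
  · linarith [hc'.lt_add, hc.lt]
  · linarith [hc.lt_add, hc'.lt]

/-- A segment with ends on the boundary, which cuts off an arc below it and which lies on a
line through the interior, is a chord in the above sense. -/
lemma isChord_of_arc (hK : IsConvexBody K) (hγ : IsC2BoundaryParam K γ T) {θ s t : ℝ} {p : Plane}
    (hp : p ∈ interior K) (hst : s < t) (htT : t < s + T)
    (hs : inner ℝ (γ s) (dir θ) = inner ℝ p (dir θ))
    (ht : inner ℝ (γ t) (dir θ) = inner ℝ p (dir θ))
    (harc : ∀ u ∈ Set.Icc s t, inner ℝ (γ u) (dir θ) ≤ inner ℝ p (dir θ)) :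
    IsChord K γ T θ s t := by
  have hs1 := hγ.cross_neg hp hs
  have ht1 := hγ.cross_neg hp ht
  have ds : inner ℝ (deriv γ s) (dir θ) ≤ 0 := by
    have h := (hasDerivAt_iff_tendsto_slope.1 (hγ.hasDerivAt_level (dir θ) s)).mono_left
      (nhdsWithin_mono s (fun v hv => ne_of_gt hv : Set.Ioi s ⊆ {s}ᶜ))
    refine le_of_tendsto h ?_
    filter_upwards [Ioo_mem_nhdsGT hst] with v hv
    rw [slope_def_field]
    exact div_nonpos_of_nonpos_of_nonneg (by linarith [harc v ⟨hv.1.le, hv.2.le⟩])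
      (by linarith [hv.1])
  have dt : 0 ≤ inner ℝ (deriv γ t) (dir θ) := by
    have h := (hasDerivAt_iff_tendsto_slope.1 (hγ.hasDerivAt_level (dir θ) t)).mono_left
      (nhdsWithin_mono t (fun v hv => ne_of_lt hv : Set.Iio t ⊆ {t}ᶜ))
    refine ge_of_tendsto h ?_
    filter_upwards [Ioo_mem_nhdsLT hst] with v hv
    rw [slope_def_field]
    exact div_nonneg_of_nonpos (by linarith [harc v ⟨hv.1.le, hv.2.le⟩]) (by linarith [hv.2])
  have as : 0 < inner ℝ (p - γ s) (tangDir θ) := pos_of_mul_neg_right hs1 ds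
  have at' : inner ℝ (p - γ t) (tangDir θ) < 0 := neg_of_mul_neg_right ht1 dt
  rw [inner_sub_left] at as at'
  refine ⟨hst, htT, hs.trans ht.symm, by rw [inner_sub_left]; linarith, ?_⟩
  have hml : inner ℝ ((1 / 2 : ℝ) • (γ s + γ t)) (dir θ) = inner ℝ p (dir θ) := by
    simp only [real_inner_smul_left, inner_add_left]; linarith
  have hmt : inner ℝ ((1 / 2 : ℝ) • (γ s + γ t)) (tangDir θ) =
      1 / 2 * (inner ℝ (γ s) (tangDir θ) + inner ℝ (γ t) (tangDir θ)) := by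
    simp only [real_inner_smul_left, inner_add_left]
  set A := inner ℝ (γ s) (tangDir θ)
  set B := inner ℝ (γ t) (tangDir θ)
  set P := inner ℝ p (tangDir θ)
  rcases le_total (1 / 2 * (A + B)) P with h | h
  · refine hK.level_mem_interior (θ := θ) (r := (P - 1 / 2 * (A + B)) / (P - A)) hp
      (hK.frontier_subset (hγ.mem_frontier s)) hs hml (div_nonneg (by linarith) (by linarith)) ?_ ?_
    · rw [div_lt_one (by linarith)]; linarith
    · have : P - A ≠ 0 := by linarith
      rw [hmt]; field_simp; ring
  · refine hK.level_mem_interior (θ := θ) (r := (1 / 2 * (A + B) - P) / (B - P)) hp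
      (hK.frontier_subset (hγ.mem_frontier t)) ht hml (div_nonneg (by linarith) (by linarith)) ?_ ?_
    · rw [div_lt_one (by linarith)]; linarith
    · have : B - P ≠ 0 := by linarith
      rw [hmt]; field_simp; ring

lemma exists_isChord (hK : IsConvexBody K) (hγ : IsC2BoundaryParam K γ T) (θ : ℝ) {p : Plane}
    (hp : p ∈ interior K) :
    ∃ s t, IsChord K γ T θ s t ∧ inner ℝ (γ s) (dir θ) = inner ℝ p (dir θ) := by
  have hcont : Continuous γ := hγ.contDiff.continuous
  have hT := hγ.period_pos
  set f : ℝ → ℝ := fun u => inner ℝ (γ u) (dir θ) - inner ℝ p (dir θ) with hf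
  have hfc : Continuous f := by fun_prop
  have hfT : ∀ u, f (u + T) = f u := fun u => by simp only [hf, hγ.periodic u]
  have key : ∀ v : Plane, v ≠ 0 → ∃ u, ∃ μ : ℝ, 0 < μ ∧ f u = μ * inner ℝ v (dir θ) := by
    intro v hv
    obtain ⟨μ, hμ, hfr⟩ := hK.exists_ray_mem_frontier hp hv
    rw [← hγ.range_eq] at hfr
    obtain ⟨u, hu⟩ := hfr
    refine ⟨u, μ, hμ, ?_⟩
    simp only [hf, hu, inner_add_left, real_inner_smul_left]; ring
  obtain ⟨u0, μ0, hμ0, hu0⟩ := key (-dir θ) (neg_ne_zero.2 (dir_ne_zero θ))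
  obtain ⟨w, μ1, hμ1, hw⟩ := key (dir θ) (dir_ne_zero θ)
  rw [inner_neg_left, inner_dir_self] at hu0
  rw [inner_dir_self] at hw
  obtain ⟨u1, hu1, hfu1⟩ : ∃ u1 ∈ Set.Ico (u0 - T) (u0 - T + T), f w = f u1 := by
    have hper : Function.Periodic f T := hfT
    exact hper.exists_mem_Ico hT w (u0 - T)
  rw [sub_add_cancel] at hu1
  have hf1 : 0 < f u1 := by rw [← hfu1, hw]; linarith
  have hf1' : 0 < f (u1 + T) := by rw [hfT]; exact hf1
  have hf0 : f u0 < 0 := by rw [hu0]; linarith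
  have hcl : IsClosed {u | 0 ≤ f u} := isClosed_le continuous_const hfc
  obtain ⟨s, ⟨hs1, hs2⟩, hs3⟩ := (isCompact_Icc.inter_right hcl).exists_isGreatest
    (⟨u1, ⟨le_rfl, hu1.2.le⟩, hf1.le⟩ : (Set.Icc u1 u0 ∩ {u | 0 ≤ f u}).Nonempty)
  obtain ⟨t, ⟨ht1, ht2⟩, ht3⟩ := (isCompact_Icc.inter_right hcl).exists_isLeast
    (⟨u1 + T, ⟨by linarith [hu1.1], le_rfl⟩, hf1'.le⟩ :
      (Set.Icc u0 (u1 + T) ∩ {u | 0 ≤ f u}).Nonempty)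
  have hs0 : f s = 0 := by
    obtain ⟨z, hz, hz0⟩ := intermediate_value_Icc' hs1.2 hfc.continuousOn ⟨hf0.le, hs2⟩
    have : z = s := le_antisymm (hs3 ⟨⟨hs1.1.trans hz.1, hz.2⟩, hz0.ge⟩) hz.1
    rwa [← this]
  have ht0 : f t = 0 := by
    obtain ⟨z, hz, hz0⟩ := intermediate_value_Icc ht1.1 hfc.continuousOn ⟨hf0.le, ht2⟩
    have : z = t := le_antisymm hz.2 (ht3 ⟨⟨hz.1, hz.2.trans ht1.2⟩, hz0.ge⟩)
    rwa [← this]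
  have hsu : s < u0 := lt_of_le_of_ne hs1.2 fun h => by rw [← h, hs0] at hf0; exact hf0.false
  have hut : u0 < t := lt_of_le_of_ne ht1.1 fun h => by rw [h, ht0] at hf0; exact hf0.false
  have hus : u1 < s := lt_of_le_of_ne hs1.1 fun h => by rw [h, hs0] at hf1; exact hf1.false
  refine ⟨s, t, isChord_of_arc hK hγ hp (hsu.trans hut) (by linarith [ht1.2]) (sub_eq_zero.1 hs0)
    (sub_eq_zero.1 ht0) fun u hu => ?_, sub_eq_zero.1 hs0⟩
  rw [← sub_nonpos]
  change f u ≤ 0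
  by_contra! hpos
  rcases le_total u u0 with h | h
  · have : u = s := le_antisymm (hs3 ⟨⟨hus.le.trans hu.1, h⟩, hpos.le⟩) hu.1
    rw [this, hs0] at hpos; exact hpos.false
  · have : u = t := le_antisymm hu.2 (ht3 ⟨⟨h, hu.2.trans ht1.2⟩, hpos.le⟩)
    rw [this, ht0] at hpos; exact hpos.false

end Chord

/-! ### Area and first moment of the underwater part -/

/-- The coordinates of a point of the plane, as a measurable equivalence. -/
noncomputable def coordEquiv : Plane ≃ᵐ ℝ × ℝ :=
  (MeasurableEquiv.toLp 2 (Fin 2 → ℝ)).symm.trans MeasurableEquiv.finTwoArrow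

lemma measurePreserving_coordEquiv : MeasurePreserving coordEquiv volume volume :=
  (volume_preserving_finTwoArrow ℝ).comp
    (EuclideanSpace.volume_preserving_symm_measurableEquiv_toLp (Fin 2))

section

variable {K : Set Plane} {γ : ℝ → Plane} {T : ℝ}

lemma IsConvexBody.isClosed_underwater (hK : IsConvexBody K) (θ h : ℝ) :
    IsClosed (underwater K θ h) :=
  have : IsClosed {x : Plane | inner ℝ x (dir θ) ≤ h} := isClosed_le (by fun_prop) continuous_const
  hK.compact.isClosed.inter this

/-- By convexity, the rays from an interior point `p` cover `K` once: this is the injectivity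
of the polar parametrization of the boundary sectors with apex `p`. -/
lemma IsConvexBody.ray_injective (hK : IsConvexBody K) {p q q' : Plane} (hp : p ∈ interior K)
    (hq : q ∈ frontier K) (hq' : q' ∈ frontier K) {r r' : ℝ} (hr : 0 < r) (hr' : 0 < r')
    (h : p + r • (q - p) = p + r' • (q' - p)) : r = r' ∧ q = q' := by
  have h1 : r • (q - p) = r' • (q' - p) := add_left_cancel h
  wlog hle : r ≤ r' generalizing q q' r r'
  · exact (this hq' hq hr' hr h.symm h1.symm (le_of_not_ge hle)).imp Eq.symm Eq.symm
  have hrr : r = r' := by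
    by_contra hne
    apply hq'.2
    have e : q' = p + (r / r') • (q - p) := by
      rw [div_eq_inv_mul, mul_smul, h1, smul_smul, inv_mul_cancel₀ hr'.ne', one_smul]; abel
    rw [e]
    exact hK.ray_mem_interior hp (hK.frontier_subset hq) (by positivity)
      ((div_lt_one hr').2 (lt_of_le_of_ne hle hne))
  subst hrr
  refine ⟨rfl, ?_⟩
  have := smul_right_injective Plane hr.ne' h1
  exact sub_left_injective this

/-- The part of `K` below a chord is the sector of `K` over the arc below the chord, with apex
at the midpoint of the chord. -/
lemma IsChord.underwater_diff_eq (hK : IsConvexBody K) (hγ : IsC2BoundaryParam K γ T) {θ s t : ℝ}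
    (hc : IsChord K γ T θ s t) {m : Plane} (hm : m = (1 / 2 : ℝ) • (γ s + γ t)) :
    underwater K θ (inner ℝ (γ s) (dir θ)) \ {m} =
      (fun z : ℝ × ℝ => m + z.2 • (γ z.1 - m)) '' (Set.Icc s t ×ˢ Set.Ioc 0 1) := by
  have hml := hc.mid_level
  have hmi := hc.mid
  rw [← hm] at hml hmi
  apply Set.Subset.antisymm
  · rintro x ⟨⟨hxK, hxl⟩, hxm⟩
    obtain ⟨μ, hμ, hfr⟩ := hK.exists_ray_mem_frontier hmi (sub_ne_zero.2 hxm : x - m ≠ 0)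
    have hμ1 : 1 ≤ μ := by
      by_contra! h
      exact hfr.2 (hK.ray_mem_interior hmi hxK hμ.le h)
    rw [← hγ.range_eq] at hfr
    obtain ⟨w, hw⟩ := hfr
    obtain ⟨u, hu, hwu⟩ := hγ.periodic.exists_mem_Ico hγ.period_pos w s
    rw [hwu] at hw
    have hul : inner ℝ (γ u) (dir θ) ≤ inner ℝ (γ s) (dir θ) := by
      rw [hw, inner_add_left, real_inner_smul_left, inner_sub_left, hml]
      have : μ * (inner ℝ x (dir θ) - inner ℝ (γ s) (dir θ)) ≤ 0 :=
        mul_nonpos_of_nonneg_of_nonpos hμ.le (by linarith)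
      linarith
    refine ⟨(u, μ⁻¹), ⟨⟨hu.1, ?_⟩, inv_pos.2 hμ, inv_le_one_of_one_le₀ hμ1⟩, ?_⟩
    · by_contra! h
      exact absurd (hc.arc_above hK hγ u ⟨h, hu.2⟩) (not_lt.2 hul)
    · simp only [hw, add_sub_cancel_left, smul_smul, inv_mul_cancel₀ hμ.ne', one_smul]
      abel
  · rintro _ ⟨⟨u, r⟩, ⟨⟨hu1, hu2⟩, hr0, hr1⟩, rfl⟩
    have hul : inner ℝ (γ u) (dir θ) ≤ inner ℝ (γ s) (dir θ) := by
      rcases eq_or_lt_of_le hu1 with h | h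
      · rw [h]
      rcases eq_or_lt_of_le hu2 with h' | h'
      · simp only at h'; rw [h', hc.level]
      exact (hc.arc_below hK hγ u ⟨h, h'⟩).le
    refine ⟨⟨?_, ?_⟩, ?_⟩
    · exact hK.convex.add_smul_sub_mem (interior_subset hmi)
        (hK.frontier_subset (hγ.mem_frontier u)) ⟨hr0.le, hr1⟩
    · simp only at hr0 hr1
      simp only [inner_add_left, real_inner_smul_left, inner_sub_left, hml]
      have : r * (inner ℝ (γ u) (dir θ) - inner ℝ (γ s) (dir θ)) ≤ 0 :=
        mul_nonpos_of_nonneg_of_nonpos hr0.le (by linarith)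
      linarith
    · simp only [Set.mem_singleton_iff, add_eq_left, smul_eq_zero, not_or]
      refine ⟨ne_of_gt hr0, fun h => ?_⟩
      rw [sub_eq_zero] at h
      exact (hγ.mem_frontier u).2 (h ▸ hmi)

/-- Integration over the part of `K` below a chord, in the coordinates `(u, r) ↦ m + r (γ u - m)`
with apex at the midpoint `m` of the chord. -/
lemma IsChord.setIntegral_underwater (hK : IsConvexBody K) (hγ : IsC2BoundaryParam K γ T)
    {θ s t : ℝ} (hc : IsChord K γ T θ s t) {m : Plane} (hm : m = (1 / 2 : ℝ) • (γ s + γ t))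
    {g : Plane → ℝ} (hg : Continuous g) :
    ∫ x in underwater K θ (inner ℝ (γ s) (dir θ)), g x =
      ∫ u in s..t, ∫ r in (0 : ℝ)..1, r * det (γ u - m) (deriv γ u) * g (m + r • (γ u - m)) := by
  have hmi := hc.mid
  rw [← hm] at hmi
  have hγc : Continuous γ := hγ.contDiff.continuous
  have hγc' := hγ.continuous_deriv
  set Φ : ℝ × ℝ → ℝ × ℝ := fun z => coordEquiv (m + z.2 • (γ z.1 - m)) with hΦ
  set S : Set (ℝ × ℝ) := Set.Icc s t ×ˢ Set.Ioc 0 1 with hS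
  have hSm : MeasurableSet S := measurableSet_Icc.prod measurableSet_Ioc
  have hJpos : ∀ u, 0 < det (γ u - m) (deriv γ u) := fun u => by
    have := hγ.left u m hmi
    simp only [det, PiLp.sub_apply] at this ⊢
    linarith
  have hinj : Set.InjOn Φ S := by
    rintro ⟨u, r⟩ ⟨hu, hr⟩ ⟨v, r'⟩ ⟨hv, hr'⟩ h
    obtain ⟨h1, h2⟩ := hK.ray_injective hmi (hγ.mem_frontier u) (hγ.mem_frontier v) hr.1 hr'.1
      (coordEquiv.injective h)
    have := hc.lt_add
    simp only [Set.mem_Icc] at hu hv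
    exact Prod.ext (hγ.eq_of_eq h2 (by linarith [hu.2, hv.1]) (by linarith [hu.1, hv.2])) h1
  have hderiv : ∀ z : ℝ × ℝ, HasFDerivAt Φ
      (Matrix.toLin (.finTwoProd ℝ) (.finTwoProd ℝ)
        !![z.2 * deriv γ z.1 0, γ z.1 0 - m 0;
           z.2 * deriv γ z.1 1, γ z.1 1 - m 1]).toContinuousLinearMap z := by
    intro z
    rw [Matrix.toLin_finTwoProd_toContinuousLinearMap]
    have hcomp : ∀ i : Fin 2, HasFDerivAt (fun z : ℝ × ℝ => m i + z.2 * (γ z.1 i - m i))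
        ((z.2 * deriv γ z.1 i) • ContinuousLinearMap.fst ℝ ℝ ℝ +
          (γ z.1 i - m i) • ContinuousLinearMap.snd ℝ ℝ ℝ) z := by
      intro i
      have h1 : HasDerivAt (fun u => γ u i) (deriv γ z.1 i) z.1 :=
        (EuclideanSpace.proj (𝕜 := ℝ) i).hasFDerivAt.comp_hasDerivAt z.1 (hγ.hasDerivAt z.1)
      have h2 := (hasFDerivAt_snd (𝕜 := ℝ) (p := z)).mul
        ((h1.comp_hasFDerivAt z (hasFDerivAt_fst (𝕜 := ℝ))).sub_const (m i))
      refine (h2.const_add (m i)).congr_fderiv ?_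
      ext <;> simp [mul_comm]
    exact (hcomp 0).prodMk (hcomp 1)
  have himg : coordEquiv ⁻¹' (Φ '' S) = underwater K θ (inner ℝ (γ s) (dir θ)) \ {m} := by
    rw [hc.underwater_diff_eq hK hγ hm, hΦ, ← Set.image_image (g := coordEquiv),
      coordEquiv.injective.preimage_image]
  have h1 : ∫ x in underwater K θ (inner ℝ (γ s) (dir θ)), g x =
      ∫ x in coordEquiv ⁻¹' (Φ '' S), (g ∘ coordEquiv.symm) (coordEquiv x) := by
    rw [himg]
    simp only [Function.comp_apply, MeasurableEquiv.symm_apply_apply]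
    refine setIntegral_congr_set (Filter.EventuallyEq.symm ?_)
    exact sdiff_null_ae_eq_self (by simp)
  rw [h1, measurePreserving_coordEquiv.setIntegral_preimage_emb
    coordEquiv.measurableEmbedding,
    integral_image_eq_integral_abs_det_fderiv_smul volume hSm
      (fun z _ => (hderiv z).hasFDerivWithinAt) hinj]
  have h2 : ∀ z ∈ S, |(Matrix.toLin (.finTwoProd ℝ) (.finTwoProd ℝ)
        !![z.2 * deriv γ z.1 0, γ z.1 0 - m 0;
           z.2 * deriv γ z.1 1, γ z.1 1 - m 1]).toContinuousLinearMap.det| •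
        (g ∘ coordEquiv.symm) (Φ z) =
      z.2 * det (γ z.1 - m) (deriv γ z.1) * g (m + z.2 • (γ z.1 - m)) := by
    rintro ⟨u, r⟩ ⟨hu, hr⟩
    have hdet : (Matrix.toLin (.finTwoProd ℝ) (.finTwoProd ℝ)
        !![r * deriv γ u 0, γ u 0 - m 0;
           r * deriv γ u 1, γ u 1 - m 1]).toContinuousLinearMap.det =
        -(r * det (γ u - m) (deriv γ u)) := by
      simp only [LinearMap.det_toContinuousLinearMap, LinearMap.det_toLin, Matrix.det_fin_two_of,
        det, PiLp.sub_apply]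
      ring
    simp only [hdet, abs_neg, Function.comp_apply, hΦ, MeasurableEquiv.symm_apply_apply,
      smul_eq_mul]
    rw [abs_of_pos (mul_pos hr.1 (hJpos u))]
  rw [setIntegral_congr_fun hSm h2]
  have hcontJ : Continuous fun z : ℝ × ℝ =>
      z.2 * det (γ z.1 - m) (deriv γ z.1) * g (m + z.2 • (γ z.1 - m)) := by
    unfold det; fun_prop
  have hint : IntegrableOn (fun z : ℝ × ℝ =>
      z.2 * det (γ z.1 - m) (deriv γ z.1) * g (m + z.2 • (γ z.1 - m))) S (volume.prod volume) :=
    (hcontJ.continuousOn.integrableOn_compact (isCompact_Icc.prod isCompact_Icc)).mono_set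
      (Set.prod_mono_right Set.Ioc_subset_Icc_self)
  rw [hS, Measure.volume_eq_prod, setIntegral_prod _ hint, intervalIntegral.integral_of_le hc.lt.le,
    ← integral_Icc_eq_integral_Ioc]
  simp only [intervalIntegral.integral_of_le (zero_le_one' ℝ)]

/-- The area between the arc `γ([s, t])` and its chord. -/
noncomputable def capArea (γ : ℝ → Plane) (s t : ℝ) : ℝ :=
  (1 / 2) * ((∫ u in s..t, det (γ u) (deriv γ u)) + det (γ t) (γ s))

/-- The first moment (coordinate `i`) of the region between the arc `γ([s, t])` and its chord. -/
noncomputable def capMoment (γ : ℝ → Plane) (i : Fin 2) (s t : ℝ) : ℝ :=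
  (1 / 3) * (∫ u in s..t, γ u i * det (γ u) (deriv γ u)) +
    (1 / 6) * ((γ s i + γ t i) * det (γ t) (γ s))

lemma IsC2BoundaryParam.hasDerivAt_coord (hγ : IsC2BoundaryParam K γ T) (u : ℝ) (i : Fin 2) :
    HasDerivAt (fun u => γ u i) (deriv γ u i) u :=
  (EuclideanSpace.proj (𝕜 := ℝ) i).hasFDerivAt.comp_hasDerivAt u (hγ.hasDerivAt u)

lemma IsChord.volume_underwater (hK : IsConvexBody K) (hγ : IsC2BoundaryParam K γ T)
    {θ s t : ℝ} (hc : IsChord K γ T θ s t) :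
    volume.real (underwater K θ (inner ℝ (γ s) (dir θ))) = capArea γ s t := by
  have hγc : Continuous γ := hγ.contDiff.continuous
  have hγc' := hγ.continuous_deriv
  have h := hc.setIntegral_underwater hK hγ rfl (g := fun _ => 1) continuous_const
  rw [setIntegral_const, smul_eq_mul, mul_one] at h
  rw [h, capArea]
  set m := (1 / 2 : ℝ) • (γ s + γ t) with hm
  have h1 : ∀ u, ∫ r in (0 : ℝ)..1, r * det (γ u - m) (deriv γ u) * 1 =
      (1 / 2) * (det (γ u) (deriv γ u) - det m (deriv γ u)) := by
    intro u
    simp only [mul_one, intervalIntegral.integral_mul_const, integral_id]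
    simp only [det, PiLp.sub_apply]; ring
  simp only [h1]
  have hi1 : IntervalIntegrable (fun u => det (γ u) (deriv γ u)) volume s t := by
    unfold det; exact Continuous.intervalIntegrable (by fun_prop) _ _
  have hi2 : IntervalIntegrable (fun u => det m (deriv γ u)) volume s t := by
    unfold det; exact Continuous.intervalIntegrable (by fun_prop) _ _
  have h2 : ∫ u in s..t, det m (deriv γ u) = det m (γ t) - det m (γ s) := by
    refine intervalIntegral.integral_eq_sub_of_hasDerivAt (f := fun u => det m (γ u))
      (fun u _ => ?_) hi2
    exact ((hγ.hasDerivAt_coord u 1).const_mul (m 0)).sub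
      ((hγ.hasDerivAt_coord u 0).const_mul (m 1))
  rw [intervalIntegral.integral_const_mul, intervalIntegral.integral_sub hi1 hi2, h2, hm]
  simp only [det, PiLp.smul_apply, PiLp.add_apply, smul_eq_mul]
  ring

lemma IsChord.moment_underwater (hK : IsConvexBody K) (hγ : IsC2BoundaryParam K γ T)
    {θ s t : ℝ} (hc : IsChord K γ T θ s t) (i : Fin 2) :
    ∫ x in underwater K θ (inner ℝ (γ s) (dir θ)), x i = capMoment γ i s t := by
  have hγc : Continuous γ := hγ.contDiff.continuous
  have hγc' := hγ.continuous_deriv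
  rw [hc.setIntegral_underwater hK hγ rfl (g := fun x => x i) (by fun_prop), capMoment]
  set m := (1 / 2 : ℝ) • (γ s + γ t) with hm
  have h1 : ∀ u, ∫ r in (0 : ℝ)..1, r * det (γ u - m) (deriv γ u) * (m + r • (γ u - m)) i =
      (1 / 6 * m i + 1 / 3 * γ u i) * det (γ u - m) (deriv γ u) := by
    intro u
    have e : ∀ r : ℝ, r * det (γ u - m) (deriv γ u) * (m + r • (γ u - m)) i =
        (det (γ u - m) (deriv γ u) * m i) * r +
          (det (γ u - m) (deriv γ u) * (γ u i - m i)) * r ^ 2 := by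
      intro r
      simp only [PiLp.add_apply, PiLp.smul_apply, PiLp.sub_apply, smul_eq_mul]; ring
    simp only [e]
    rw [intervalIntegral.integral_add (Continuous.intervalIntegrable (by fun_prop) _ _)
      (Continuous.intervalIntegrable (by fun_prop) _ _), intervalIntegral.integral_const_mul,
      intervalIntegral.integral_const_mul, integral_id, integral_pow]
    norm_num; ring
  simp only [h1]
  -- the integrand differs from that of the sector with apex `0` by the derivative of the moment
  -- of the triangle with vertices `0`, `γ u`, `m`
  have h2 : ∀ u, (1 / 6 * m i + 1 / 3 * γ u i) * det (γ u - m) (deriv γ u) =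
      1 / 3 * (γ u i * det (γ u) (deriv γ u)) +
        (1 / 6) * (deriv γ u i * det (γ u) m + (γ u i + m i) * det (deriv γ u) m) := by
    intro u
    fin_cases i <;> simp only [det, PiLp.sub_apply, Fin.zero_eta, Fin.mk_one] <;> ring
  have h3 : ∫ u in s..t, (1 / 6) * (deriv γ u i * det (γ u) m +
      (γ u i + m i) * det (deriv γ u) m) =
      (1 / 6) * ((γ t i + m i) * det (γ t) m) - (1 / 6) * ((γ s i + m i) * det (γ s) m) := by
    refine intervalIntegral.integral_eq_sub_of_hasDerivAt
      (f := fun u => (1 / 6) * ((γ u i + m i) * det (γ u) m)) (fun u _ => ?_) ?_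
    · have hd : HasDerivAt (fun u => det (γ u) m) (det (deriv γ u) m) u :=
        ((hγ.hasDerivAt_coord u 0).mul_const (m 1)).sub
          ((hγ.hasDerivAt_coord u 1).mul_const (m 0))
      exact (((hγ.hasDerivAt_coord u i).add_const (m i)).mul hd).const_mul _
    · unfold det; exact Continuous.intervalIntegrable (by fun_prop) _ _
  simp only [h2]
  rw [intervalIntegral.integral_add, h3, intervalIntegral.integral_const_mul, hm]
  · simp only [det, PiLp.smul_apply, PiLp.add_apply, smul_eq_mul]
    ring
  · unfold det; exact Continuous.intervalIntegrable (by fun_prop) _ _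
  · unfold det; exact Continuous.intervalIntegrable (by fun_prop) _ _

end

/-! ### Existence and uniqueness of water surfaces -/

section

variable {K : Set Plane}

lemma volume_level_eq_zero (θ h : ℝ) : volume {x : Plane | inner ℝ x (dir θ) = h} = 0 := by
  set A : AffineSubspace ℝ Plane :=
    AffineSubspace.mk' (h • dir θ) (LinearMap.ker (innerₛₗ ℝ (dir θ))) with hA
  have hmem : ∀ x, x ∈ A ↔ inner ℝ x (dir θ) = h := by
    intro x
    rw [hA, AffineSubspace.mem_mk', LinearMap.mem_ker, vsub_eq_sub, innerₛₗ_apply_apply,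
      real_inner_comm, inner_sub_left, real_inner_smul_left, inner_dir_self, mul_one, sub_eq_zero]
  have hset : {x : Plane | inner ℝ x (dir θ) = h} = A := by
    ext x; exact (hmem x).symm
  rw [hset]
  refine Measure.addHaar_affineSubspace volume A fun htop => ?_
  have h1 := (hmem ((h + 1) • dir θ)).1 (htop ▸ AffineSubspace.mem_top ℝ Plane _)
  rw [real_inner_smul_left, inner_dir_self] at h1
  linarith

lemma IsConvexBody.volume_ne_top (hK : IsConvexBody K) : volume K ≠ ⊤ :=
  hK.compact.measure_lt_top.ne

lemma underwater_subset (θ h : ℝ) : underwater K θ h ⊆ K := fun _ hx => hx.1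

lemma IsConvexBody.underwater_ne_top (hK : IsConvexBody K) (θ h : ℝ) :
    volume (underwater K θ h) ≠ ⊤ :=
  measure_ne_top_of_subset (underwater_subset θ h) hK.volume_ne_top

lemma IsConvexBody.underwater_mono (hK : IsConvexBody K) (θ : ℝ) {h h' : ℝ} (hh : h ≤ h') :
    volume.real (underwater K θ h) ≤ volume.real (underwater K θ h') :=
  measureReal_mono (fun _ hx => ⟨hx.1, hx.2.trans hh⟩) (hK.underwater_ne_top θ h')

/-- A line which has a part of `K` of positive area on each side meets the interior of `K`. -/
lemma IsConvexBody.exists_interior_level (hK : IsConvexBody K) {θ h : ℝ}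
    (h0 : 0 < volume.real (underwater K θ h))
    (h1 : volume.real (underwater K θ h) < volume.real K) :
    ∃ p ∈ interior K, inner ℝ p (dir θ) = h := by
  have hcont : Continuous fun x : Plane => inner ℝ x (dir θ) := by fun_prop
  have hdense : ∀ U : Set Plane, IsOpen U → (∃ x ∈ K, x ∈ U) → ∃ x ∈ interior K, x ∈ U := by
    rintro U hU ⟨x, hxK, hxU⟩
    rw [← hK.closure_interior] at hxK
    obtain ⟨y, hy1, hy2⟩ := mem_closure_iff.1 hxK U hU hxU
    exact ⟨y, hy2, hy1⟩
  obtain ⟨x, hx, hxh⟩ : ∃ x ∈ interior K, inner ℝ x (dir θ) < h := by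
    refine hdense _ (isOpen_lt hcont continuous_const) ?_
    by_contra! hcon
    refine absurd h0 (not_lt.2 (le_of_eq ?_))
    have : volume (underwater K θ h) = 0 :=
      measure_mono_null (fun x hx => le_antisymm hx.2 (not_lt.1 (hcon x hx.1)))
        (volume_level_eq_zero θ h)
    rw [measureReal_def, this]; rfl
  obtain ⟨y, hy, hyh⟩ : ∃ y ∈ interior K, h < inner ℝ y (dir θ) := by
    refine hdense _ (isOpen_lt continuous_const hcont) ?_
    by_contra! hcon
    refine absurd h1 (not_lt.2 (le_of_eq ?_))
    congr 1
    exact Set.Subset.antisymm (fun x hx => ⟨hx, not_lt.1 (hcon x hx)⟩) (underwater_subset θ h)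
  exact hK.convex.interior.isPreconnected.intermediate_value hx hy hcont.continuousOn
    ⟨hxh.le, hyh.le⟩

lemma IsConvexBody.underwater_strictMono (hK : IsConvexBody K) {θ h h' : ℝ}
    (h0 : 0 < volume.real (underwater K θ h))
    (h1 : volume.real (underwater K θ h) < volume.real K) (hh : h < h') :
    volume.real (underwater K θ h) < volume.real (underwater K θ h') := by
  have hcont : Continuous fun x : Plane => inner ℝ x (dir θ) := by fun_prop
  obtain ⟨p, hp, hph⟩ := hK.exists_interior_level h0 h1
  set U : Set Plane := interior K ∩ {x | h < inner ℝ x (dir θ) ∧ inner ℝ x (dir θ) < h'} with hU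
  have hUo : IsOpen U := isOpen_interior.inter
    ((isOpen_lt continuous_const hcont).inter (isOpen_lt hcont continuous_const))
  have hUn : U.Nonempty := by
    have hc : Continuous fun ε : ℝ => p + ε • dir θ := by fun_prop
    have h2 : ∀ᶠ ε in nhdsWithin (0 : ℝ) (Set.Ioi 0), p + ε • dir θ ∈ interior K :=
      (hc.tendsto' 0 p (by simp)).eventually (isOpen_interior.mem_nhds hp)
        |>.filter_mono nhdsWithin_le_nhds
    obtain ⟨ε, hε, hε'⟩ := (h2.and (Ioo_mem_nhdsGT (sub_pos.2 hh))).exists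
    refine ⟨_, hε, ?_⟩
    simp only [Set.mem_ofPred_eq, inner_add_left, real_inner_smul_left, inner_dir_self, hph]
    exact ⟨by linarith [hε'.1], by linarith [hε'.2]⟩
  have hUfin : volume U ≠ ⊤ :=
    measure_ne_top_of_subset (Set.inter_subset_left.trans interior_subset) hK.volume_ne_top
  have hUpos : 0 < volume.real U := ENNReal.toReal_pos (hUo.measure_pos volume hUn).ne' hUfin
  have hdisj : Disjoint (underwater K θ h) U :=
    Set.disjoint_left.2 fun x hx hxU => absurd hx.2 (not_le.2 hxU.2.1)
  have h3 : volume.real (underwater K θ h ∪ U) =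
      volume.real (underwater K θ h) + volume.real U :=
    measureReal_union hdisj hUo.measurableSet (hK.underwater_ne_top θ h) hUfin
  have h4 : volume.real (underwater K θ h ∪ U) ≤ volume.real (underwater K θ h') :=
    measureReal_mono (Set.union_subset (fun x hx => ⟨hx.1, hx.2.trans hh.le⟩)
      fun x hx => ⟨interior_subset hx.1, hx.2.2.le⟩) (hK.underwater_ne_top θ h')
  linarith

lemma IsConvexBody.waterSurface_unique (hK : IsConvexBody K) {δ θ h h' : ℝ} (h0 : 0 < δ)
    (h1 : δ < volume.real K) (hh : IsWaterSurface K δ θ h) (hh' : IsWaterSurface K δ θ h') :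
    h = h' := by
  rw [IsWaterSurface] at hh hh'
  rcases lt_trichotomy h h' with hlt | heq | hgt
  · have := hK.underwater_strictMono (by rwa [hh]) (by rwa [hh]) hlt
    linarith
  · exact heq
  · have := hK.underwater_strictMono (by rwa [hh']) (by rwa [hh']) hgt
    linarith

lemma IsConvexBody.continuous_underwater (hK : IsConvexBody K) (θ : ℝ) :
    Continuous fun h => volume.real (underwater K θ h) := by
  have hcont : Continuous fun x : Plane => inner ℝ x (dir θ) := by fun_prop
  have e : (fun h => volume.real (underwater K θ h)) = fun h =>
      ∫ x in K, Set.indicator {x : Plane | inner ℝ x (dir θ) ≤ h} (fun _ => (1 : ℝ)) x := by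
    ext h
    have hm : MeasurableSet {x : Plane | inner ℝ x (dir θ) ≤ h} :=
      (isClosed_le hcont continuous_const).measurableSet
    rw [setIntegral_indicator hm, setIntegral_const, smul_eq_mul, mul_one]
    rfl
  rw [e, continuous_iff_continuousAt]
  intro h
  refine continuousAt_of_dominated (bound := fun _ => 1) ?_ ?_ ?_ ?_
  · refine Filter.Eventually.of_forall fun h' => ?_
    have hm : MeasurableSet {x : Plane | inner ℝ x (dir θ) ≤ h'} :=
      (isClosed_le hcont continuous_const).measurableSet
    exact ((measurable_const (a := (1 : ℝ))).indicator hm).aestronglyMeasurable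
  · refine Filter.Eventually.of_forall fun h' => Filter.Eventually.of_forall fun x => ?_
    exact (norm_indicator_le_norm_self (fun _ => (1 : ℝ)) x).trans_eq norm_one
  · exact integrableOn_const hK.volume_ne_top
  · have hn : ∀ᵐ x : Plane ∂(volume.restrict K), inner ℝ x (dir θ) ≠ h := by
      refine ae_restrict_of_ae ?_
      rw [ae_iff]
      simpa using volume_level_eq_zero θ h
    filter_upwards [hn] with x hx
    rcases lt_or_gt_of_ne hx with hlt | hgt
    · refine (continuousAt_const (y := (1 : ℝ))).congr ?_
      filter_upwards [lt_mem_nhds hlt] with h' hh'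
      exact (Set.indicator_of_mem (show x ∈ {x : Plane | inner ℝ x (dir θ) ≤ h'} from hh'.le)
        (fun _ => (1 : ℝ))).symm
    · refine (continuousAt_const (y := (0 : ℝ))).congr ?_
      filter_upwards [gt_mem_nhds hgt] with h' hh'
      exact (Set.indicator_of_notMem
        (show x ∉ {x : Plane | inner ℝ x (dir θ) ≤ h'} from not_le.2 hh')
        (fun _ => (1 : ℝ))).symm

lemma IsConvexBody.exists_waterSurface (hK : IsConvexBody K) {δ : ℝ} (h0 : 0 < δ)
    (h1 : δ < volume.real K) (θ : ℝ) : ∃ h, IsWaterSurface K δ θ h := by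
  obtain ⟨R, hR⟩ := hK.compact.exists_bound_of_continuousOn
    (f := fun x : Plane => inner ℝ x (dir θ)) (by fun_prop)
  simp only [Real.norm_eq_abs, abs_le] at hR
  have hlow : volume.real (underwater K θ (-R - 1)) = 0 := by
    have : underwater K θ (-R - 1) = ∅ := by
      ext x
      simp only [Set.mem_empty_iff_false, iff_false]
      intro hx
      linarith [(hR x hx.1).1, hx.2]
    rw [this]; simp
  have hhigh : volume.real (underwater K θ (R + 1)) = volume.real K := by
    congr 1
    exact Set.Subset.antisymm (underwater_subset _ _)
      fun x hx => ⟨hx, by linarith [(hR x hx).2]⟩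
  exact mem_range_of_exists_le_of_exists_ge (hK.continuous_underwater θ)
    ⟨_, hlow.le.trans h0.le⟩ ⟨_, h1.le.trans hhigh.ge⟩

lemma IsConvexBody.underwater_add_pi (hK : IsConvexBody K) (θ h : ℝ) :
    volume.real (underwater K (θ + Real.pi) (-h)) =
      volume.real K - volume.real (underwater K θ h) := by
  have hcont : Continuous fun x : Plane => inner ℝ x (dir θ) := by fun_prop
  have hm : MeasurableSet (underwater K θ h) :=
    hK.compact.measurableSet.inter (isClosed_le hcont continuous_const).measurableSet
  have e : K \ underwater K θ h = underwater K (θ + Real.pi) (-h) \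
      {x : Plane | inner ℝ x (dir θ) = h} := by
    ext x
    have : x ∈ underwater K (θ + Real.pi) (-h) ↔ x ∈ K ∧ h ≤ inner ℝ x (dir θ) := by
      show x ∈ K ∧ inner ℝ x (dir (θ + Real.pi)) ≤ -h ↔ _
      rw [dir_add_pi, inner_neg_right, neg_le_neg_iff]
    rw [Set.mem_sdiff, Set.mem_sdiff, this]
    constructor
    · rintro ⟨hx, hx'⟩
      have : h < inner ℝ x (dir θ) := by
        by_contra! hle
        exact hx' ⟨hx, hle⟩
      exact ⟨⟨hx, this.le⟩, this.ne'⟩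
    · rintro ⟨⟨hx, hle⟩, hne⟩
      exact ⟨hx, fun hx' => hne (le_antisymm hx'.2 hle)⟩
  rw [← measureReal_sdiff (underwater_subset θ h) hm hK.volume_ne_top, e, measureReal_def,
    measureReal_def, measure_sdiff_null (volume_level_eq_zero θ h)]

end

/-! ### Chords of constant area as a differentiable family -/

section

variable {K : Set Plane} {γ : ℝ → Plane} {T : ℝ}

lemma hasDerivAt_integral_moving {f : ℝ → ℝ} (hf : Continuous f) {S R : ℝ → ℝ} {s' r' θ : ℝ}
    (hS : HasDerivAt S s' θ) (hR : HasDerivAt R r' θ) :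
    HasDerivAt (fun θ => ∫ u in S θ..R θ, f u) (f (R θ) * r' - f (S θ) * s') θ := by
  have e : (fun θ => ∫ u in S θ..R θ, f u) =
      fun θ => (∫ u in (0 : ℝ)..R θ, f u) - ∫ u in (0 : ℝ)..S θ, f u := by
    ext θ
    rw [intervalIntegral.integral_interval_sub_left (hf.intervalIntegrable _ _)
      (hf.intervalIntegrable _ _)]
  rw [e]
  exact ((hf.integral_hasStrictDerivAt 0 (R θ)).hasDerivAt.comp θ hR).sub
    ((hf.integral_hasStrictDerivAt 0 (S θ)).hasDerivAt.comp θ hS)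

lemma IsC2BoundaryParam.continuous_det (hγ : IsC2BoundaryParam K γ T) :
    Continuous fun u => det (γ u) (deriv γ u) := by
  have := hγ.contDiff.continuous
  have := hγ.continuous_deriv
  unfold det; fun_prop

lemma IsC2BoundaryParam.hasDerivAt_coord_comp (hγ : IsC2BoundaryParam K γ T) {S : ℝ → ℝ}
    {s' θ : ℝ} (hS : HasDerivAt S s' θ) (i : Fin 2) :
    HasDerivAt (fun θ => γ (S θ) i) (deriv γ (S θ) i * s') θ :=
  (hγ.hasDerivAt_coord (S θ) i).comp θ hS

lemma IsC2BoundaryParam.hasDerivAt_capArea (hγ : IsC2BoundaryParam K γ T) {S R : ℝ → ℝ}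
    {s' r' θ : ℝ} (hS : HasDerivAt S s' θ) (hR : HasDerivAt R r' θ) :
    HasDerivAt (fun θ => capArea γ (S θ) (R θ))
      ((1 / 2) * (det (γ (R θ) - γ (S θ)) (deriv γ (S θ)) * s' +
        det (γ (R θ) - γ (S θ)) (deriv γ (R θ)) * r')) θ := by
  have h1 := hasDerivAt_integral_moving hγ.continuous_det hS hR
  have h2 : ∀ i j, HasDerivAt (fun θ => γ (R θ) i * γ (S θ) j) _ θ := fun i j =>
    (hγ.hasDerivAt_coord_comp hR i).mul (hγ.hasDerivAt_coord_comp hS j)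
  have h3 := (h1.add ((h2 0 1).sub (h2 1 0))).const_mul (1 / 2)
  refine h3.congr_deriv ?_
  simp only [det, PiLp.sub_apply]; ring

/-- The first moment changes by the mass swept by the moving chord; in the first summand the ends
of the chord have weights `1/3` and `1/6`, since its motion decreases linearly to zero from
`γ (S θ)` to `γ (R θ)`. -/
lemma IsC2BoundaryParam.hasDerivAt_capMoment (hγ : IsC2BoundaryParam K γ T) {S R : ℝ → ℝ}
    {s' r' θ : ℝ} (hS : HasDerivAt S s' θ) (hR : HasDerivAt R r' θ) (i : Fin 2) :
    HasDerivAt (fun θ => capMoment γ i (S θ) (R θ))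
      (det (γ (R θ) - γ (S θ)) (deriv γ (S θ)) * s' * (1 / 3 * γ (S θ) i + 1 / 6 * γ (R θ) i) +
        det (γ (R θ) - γ (S θ)) (deriv γ (R θ)) * r' *
          (1 / 6 * γ (S θ) i + 1 / 3 * γ (R θ) i)) θ := by
  have hc : Continuous fun u => γ u i * det (γ u) (deriv γ u) := by
    have := hγ.contDiff.continuous
    exact Continuous.mul (by fun_prop) hγ.continuous_det
  have h1 := hasDerivAt_integral_moving hc hS hR
  have h2 : ∀ i j, HasDerivAt (fun θ => γ (R θ) i * γ (S θ) j) _ θ := fun i j =>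
    (hγ.hasDerivAt_coord_comp hR i).mul (hγ.hasDerivAt_coord_comp hS j)
  have h3 := (h1.const_mul (1 / 3)).add
    ((((hγ.hasDerivAt_coord_comp hS i).add (hγ.hasDerivAt_coord_comp hR i)).mul
      ((h2 0 1).sub (h2 1 0))).const_mul (1 / 6))
  refine h3.congr_deriv ?_
  fin_cases i <;> simp only [det, PiLp.sub_apply, Fin.zero_eta, Fin.mk_one, Pi.add_apply,
    Pi.sub_apply] <;> ring

/-- The length of the chord with ends `γ s`, `γ t` and direction `tangDir θ`. -/
noncomputable def len (γ : ℝ → Plane) (θ s t : ℝ) : ℝ := inner ℝ (γ t - γ s) (tangDir θ)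

/-- The component of the velocity along the chord. -/
noncomputable def along (γ : ℝ → Plane) (θ u : ℝ) : ℝ := inner ℝ (deriv γ u) (tangDir θ)

/-- The component of the velocity normal to the chord. -/
noncomputable def across (γ : ℝ → Plane) (θ u : ℝ) : ℝ := inner ℝ (deriv γ u) (dir θ)

lemma IsChord.det_chord {θ s t : ℝ} (hc : IsChord K γ T θ s t) (v : Plane) :
    det (γ t - γ s) v = len γ θ s t * inner ℝ v (dir θ) := by
  rw [det_frame θ, inner_sub_left (γ t) (γ s) (dir θ), ← hc.level, len]; ring

/-- The pair of conditions defining a family of chords of constant area is a nondegenerate system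
of equations for the parameters of the ends. -/
lemma IsChord.exists_implicit (hγ : IsC2BoundaryParam K γ T) {θ₀ s₀ t₀ : ℝ}
    (hc : IsChord K γ T θ₀ s₀ t₀) :
    ∃ ψ : ℝ → ℝ × ℝ, ψ θ₀ = (s₀, t₀) ∧ DifferentiableAt ℝ ψ θ₀ ∧
      ∀ᶠ θ in nhds θ₀, capArea γ (ψ θ).1 (ψ θ).2 = capArea γ s₀ t₀ ∧
        inner ℝ (γ (ψ θ).2 - γ (ψ θ).1) (dir θ) = 0 := by
  set F : ℝ × (ℝ × ℝ) → ℝ × ℝ := fun v => (capArea γ v.2.1 v.2.2,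
    (γ v.2.2 0 - γ v.2.1 0) * Real.cos v.1 + (γ v.2.2 1 - γ v.2.1 1) * Real.sin v.1) with hF
  set u : ℝ × (ℝ × ℝ) := (θ₀, s₀, t₀) with hu
  have hstr : ∀ w, HasStrictDerivAt γ (deriv γ w) w := fun w =>
    hγ.contDiff.contDiffAt.hasStrictDerivAt (by norm_num)
  have hstri : ∀ w i, HasStrictDerivAt (fun w => γ w i) (deriv γ w i) w := fun w i =>
    (EuclideanSpace.proj (𝕜 := ℝ) i).hasStrictFDerivAt.comp_hasStrictDerivAt w (hstr w)
  have p2 : HasStrictFDerivAt (fun v : ℝ × (ℝ × ℝ) => v.2.1) _ u :=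
    (hasStrictFDerivAt_snd (𝕜 := ℝ) (p := u)).fst
  have p3 : HasStrictFDerivAt (fun v : ℝ × (ℝ × ℝ) => v.2.2) _ u :=
    (hasStrictFDerivAt_snd (𝕜 := ℝ) (p := u)).snd
  have hcomp : ∀ {f : ℝ → ℝ} {f' : ℝ} {P : ℝ × (ℝ × ℝ) → ℝ} {P' : ℝ × (ℝ × ℝ) →L[ℝ] ℝ},
      HasStrictDerivAt f f' (P u) → HasStrictFDerivAt P P' u →
        HasStrictFDerivAt (fun v => f (P v)) (f' • P') u :=
    fun hf hP => hf.comp_hasStrictFDerivAt u hP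
  have hs := fun i => hcomp (hstri s₀ i) p2
  have ht := fun i => hcomp (hstri t₀ i) p3
  have hBs := hcomp (hγ.continuous_det.integral_hasStrictDerivAt 0 s₀) p2
  have hBt := hcomp (hγ.continuous_det.integral_hasStrictDerivAt 0 t₀) p3
  have hcos := hcomp (Real.hasStrictDerivAt_cos θ₀) (hasStrictFDerivAt_fst (𝕜 := ℝ) (p := u))
  have hsin := hcomp (Real.hasStrictDerivAt_sin θ₀) (hasStrictFDerivAt_fst (𝕜 := ℝ) (p := u))
  have hF1 := ((hBt.sub hBs).add (((ht 0).mul (hs 1)).sub ((ht 1).mul (hs 0)))).const_mul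
    (1 / 2 : ℝ)
  have hF2 := (((ht 0).sub (hs 0)).mul hcos).add (((ht 1).sub (hs 1)).mul hsin)
  have hFd := hF1.prodMk hF2
  have hFeq : F = fun v : ℝ × (ℝ × ℝ) => ((1 / 2 : ℝ) *
      (((∫ w in (0 : ℝ)..v.2.2, det (γ w) (deriv γ w)) -
        ∫ w in (0 : ℝ)..v.2.1, det (γ w) (deriv γ w)) +
        (γ v.2.2 0 * γ v.2.1 1 - γ v.2.2 1 * γ v.2.1 0)),
      (γ v.2.2 0 - γ v.2.1 0) * Real.cos v.1 + (γ v.2.2 1 - γ v.2.1 1) * Real.sin v.1) := by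
    ext v
    · simp only [hF, capArea]
      rw [intervalIntegral.integral_interval_sub_left (hγ.continuous_det.intervalIntegrable _ _)
        (hγ.continuous_det.intervalIntegrable _ _)]
      rfl
    · rfl
  replace hFd : HasStrictFDerivAt F _ u := hFeq ▸ hFd
  set a := -across γ θ₀ s₀ with ha
  set b := across γ θ₀ t₀ with hb
  set l := len γ θ₀ s₀ t₀ with hl
  have ha0 : 0 < a := neg_pos.2 (hc.deriv_left_neg hγ)
  have hb0 : 0 < b := hc.deriv_right_pos hγ
  have hl0 : 0 < l := hc.pos
  have hds : det (γ t₀ - γ s₀) (deriv γ s₀) = -(l * a) := by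
    rw [hc.det_chord, ha, across]; ring
  have hdt : det (γ t₀ - γ s₀) (deriv γ t₀) = l * b := by rw [hc.det_chord, hb, across]
  have has : deriv γ s₀ 0 * Real.cos θ₀ + deriv γ s₀ 1 * Real.sin θ₀ = -a := by
    rw [ha, across, inner_eq, neg_neg]; rfl
  have hbt : deriv γ t₀ 0 * Real.cos θ₀ + deriv γ t₀ 1 * Real.sin θ₀ = b := by
    rw [hb, across, inner_eq]; rfl
  simp only [det, PiLp.sub_apply] at hds hdt
  obtain ⟨F', hF', hF'w⟩ : ∃ F' : ℝ × (ℝ × ℝ) →L[ℝ] ℝ × ℝ, HasStrictFDerivAt F F' u ∧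
      ∀ w : ℝ × ℝ, F' (0, w) = ((1 / 2) * l * (b * w.2 - a * w.1), a * w.1 + b * w.2) := by
    refine ⟨_, hFd, fun w => ?_⟩
    ext
    · simp [hu, det]
      linear_combination (1 / 2) * w.1 * hds + (1 / 2) * w.2 * hdt
    · simp [hu]
      linear_combination w.2 * hbt - w.1 * has
  have hinv : (F' ∘L .inr ℝ ℝ (ℝ × ℝ)).IsInvertible := by
    refine ContinuousLinearMap.IsInvertible.of_inverse
      (g := ((1 / (2 * a)) • ContinuousLinearMap.snd ℝ ℝ ℝ -
          (1 / (a * l)) • ContinuousLinearMap.fst ℝ ℝ ℝ).prod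
        ((1 / (2 * b)) • ContinuousLinearMap.snd ℝ ℝ ℝ +
          (1 / (b * l)) • ContinuousLinearMap.fst ℝ ℝ ℝ)) ?_ ?_
    all_goals
      refine ContinuousLinearMap.ext fun w => Prod.ext ?_ ?_ <;>
      simp only [ContinuousLinearMap.comp_apply, ContinuousLinearMap.inr_apply, hF'w,
        ContinuousLinearMap.prod_apply, sub_apply,
        add_apply, smul_apply,
        ContinuousLinearMap.coe_fst', ContinuousLinearMap.coe_snd', smul_eq_mul,
        ContinuousLinearMap.id_apply] <;>
      field_simp <;> ring
  have hFu : F u = (capArea γ s₀ t₀, 0) := by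
    ext
    · rfl
    · have := hc.level
      simp only [inner_eq, dir_zero, dir_one] at this
      simp only [hF, hu]
      linarith
  refine ⟨hF'.implicitFunctionOfProdDomain hinv, ?_,
    (hF'.hasStrictFDerivAt_implicitFunctionOfProdDomain hinv).differentiableAt, ?_⟩
  · exact (hF'.eventually_apply_eq_iff_implicitFunctionOfProdDomain hinv).self_of_nhds.1 rfl
  · filter_upwards [hF'.eventually_apply_implicitFunctionOfProdDomain hinv] with θ hθ
    rw [hFu] at hθ
    refine ⟨congrArg Prod.fst hθ, ?_⟩
    have h2 := congrArg Prod.snd hθ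
    simpa only [inner_eq, PiLp.sub_apply, dir_zero, dir_one] using h2

/-- Locally, the chords of constant area are parametrized by their normal angle. Both ends have
the normal velocity `len / 2`: the chord turns about its midpoint. -/
lemma IsChord.exists_local (hγ : IsC2BoundaryParam K γ T) {θ₀ s₀ t₀ : ℝ}
    (hc : IsChord K γ T θ₀ s₀ t₀) :
    ∃ S R : ℝ → ℝ, S θ₀ = s₀ ∧ R θ₀ = t₀ ∧
      HasDerivAt S (len γ θ₀ s₀ t₀ / (2 * -across γ θ₀ s₀)) θ₀ ∧
      HasDerivAt R (len γ θ₀ s₀ t₀ / (2 * across γ θ₀ t₀)) θ₀ ∧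
      ∀ᶠ θ in nhds θ₀, IsChord K γ T θ (S θ) (R θ) ∧
        capArea γ (S θ) (R θ) = capArea γ s₀ t₀ := by
  obtain ⟨ψ, hψ0, hψd, hψ⟩ := hc.exists_implicit hγ
  set S : ℝ → ℝ := fun θ => (ψ θ).1 with hS
  set R : ℝ → ℝ := fun θ => (ψ θ).2 with hR
  have hS0 : S θ₀ = s₀ := by simp [hS, hψ0]
  have hR0 : R θ₀ = t₀ := by simp [hR, hψ0]
  have hSd : HasDerivAt S (deriv S θ₀) θ₀ := hψd.fst.hasDerivAt
  have hRd : HasDerivAt R (deriv R θ₀) θ₀ := hψd.snd.hasDerivAt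
  have ha0 : 0 < -across γ θ₀ s₀ := neg_pos.2 (hc.deriv_left_neg hγ)
  have hb0 : 0 < across γ θ₀ t₀ := hc.deriv_right_pos hγ
  have hl0 : 0 < len γ θ₀ s₀ t₀ := hc.pos
  have e1 : (1 / 2) * (det (γ t₀ - γ s₀) (deriv γ s₀) * deriv S θ₀ +
      det (γ t₀ - γ s₀) (deriv γ t₀) * deriv R θ₀) = 0 := by
    have h1 := hγ.hasDerivAt_capArea hSd hRd
    rw [hS0, hR0] at h1
    refine h1.unique ((hasDerivAt_const θ₀ (capArea γ s₀ t₀)).congr_of_eventuallyEq ?_)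
    filter_upwards [hψ] with θ hθ using hθ.1
  have e2 : across γ θ₀ t₀ * deriv R θ₀ - across γ θ₀ s₀ * deriv S θ₀ = len γ θ₀ s₀ t₀ := by
    have h1 : HasDerivAt (fun θ => (γ (R θ) 0 - γ (S θ) 0) * Real.cos θ +
        (γ (R θ) 1 - γ (S θ) 1) * Real.sin θ) _ θ₀ :=
      (((hγ.hasDerivAt_coord_comp hRd 0).sub (hγ.hasDerivAt_coord_comp hSd 0)).mul
        (Real.hasDerivAt_cos θ₀)).add
      (((hγ.hasDerivAt_coord_comp hRd 1).sub (hγ.hasDerivAt_coord_comp hSd 1)).mul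
        (Real.hasDerivAt_sin θ₀))
    have h2 := h1.unique ((hasDerivAt_const θ₀ (0 : ℝ)).congr_of_eventuallyEq (by
      filter_upwards [hψ] with θ hθ
      simpa only [inner_eq, PiLp.sub_apply, dir_zero, dir_one] using hθ.2))
    simp only [hS0, hR0, Pi.sub_apply] at h2
    simp only [across, len, inner_eq, PiLp.sub_apply, dir_zero, dir_one, tangDir_zero,
      tangDir_one]
    linear_combination h2
  rw [hc.det_chord, hc.det_chord] at e1
  change (1 / 2) * (len γ θ₀ s₀ t₀ * across γ θ₀ s₀ * deriv S θ₀ +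
    len γ θ₀ s₀ t₀ * across γ θ₀ t₀ * deriv R θ₀) = 0 at e1
  have e3 : across γ θ₀ s₀ * deriv S θ₀ + across γ θ₀ t₀ * deriv R θ₀ = 0 := by
    have : len γ θ₀ s₀ t₀ *
        (across γ θ₀ s₀ * deriv S θ₀ + across γ θ₀ t₀ * deriv R θ₀) = 0 := by linarith
    exact (mul_eq_zero.1 this).resolve_left hl0.ne'
  refine ⟨S, R, hS0, hR0, hSd.congr_deriv ?_, hRd.congr_deriv ?_, ?_⟩
  · rw [eq_div_iff (by positivity)]; linarith
  · rw [eq_div_iff (by positivity)]; linarith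
  have cS := hSd.continuousAt
  have cR := hRd.continuousAt
  have cγ : Continuous γ := hγ.contDiff.continuous
  have cγS : ContinuousAt (fun θ => γ (S θ)) θ₀ := cγ.continuousAt.comp cS
  have cγR : ContinuousAt (fun θ => γ (R θ)) θ₀ := cγ.continuousAt.comp cR
  have cT : Continuous tangDir := by
    unfold tangDir; fun_prop
  have v1 : ∀ᶠ θ in nhds θ₀, S θ < R θ := cS.eventually_lt cR (by rw [hS0, hR0]; exact hc.lt)
  have v2 : ∀ᶠ θ in nhds θ₀, R θ < S θ + T :=
    cR.eventually_lt (cS.add continuousAt_const) (by rw [hS0, hR0]; exact hc.lt_add)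
  have v3 : ∀ᶠ θ in nhds θ₀, 0 < inner ℝ (γ (R θ) - γ (S θ)) (tangDir θ) := by
    refine continuousAt_const.eventually_lt ((cγR.sub cγS).inner cT.continuousAt) ?_
    rw [hS0, hR0]; exact hc.pos
  have v4 : ∀ᶠ θ in nhds θ₀, (1 / 2 : ℝ) • (γ (S θ) + γ (R θ)) ∈ interior K := by
    refine ((cγS.add cγR).const_smul (1 / 2 : ℝ)).eventually (isOpen_interior.mem_nhds ?_)
    change (1 / 2 : ℝ) • (γ (S θ₀) + γ (R θ₀)) ∈ interior K
    rw [hS0, hR0]; exact hc.mid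
  filter_upwards [hψ, v1, v2, v3, v4] with θ h0 h1 h2 h3 h4
  refine ⟨⟨h1, h2, ?_, h3, h4⟩, h0.1⟩
  have := h0.2
  rw [inner_sub_left] at this
  linarith

end

/-! ### The chords of flotation -/

/-- The chord with normal `dir θ` cuts off the area `δ`. -/
def IsCapChord (K : Set Plane) (γ : ℝ → Plane) (T δ θ s t : ℝ) : Prop :=
  IsChord K γ T θ s t ∧ capArea γ s t = δ

section

variable {K : Set Plane} {γ : ℝ → Plane} {T δ : ℝ}

lemma IsCapChord.waterSurface (hK : IsConvexBody K) (hγ : IsC2BoundaryParam K γ T) {θ s t : ℝ}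
    (hc : IsCapChord K γ T δ θ s t) : IsWaterSurface K δ θ (inner ℝ (γ s) (dir θ)) := by
  rw [IsWaterSurface, hc.1.volume_underwater hK hγ, hc.2]

lemma isFlotationChord_iff (hK : IsConvexBody K) (hγ : IsC2BoundaryParam K γ T) (h0 : 0 < δ)
    (h1 : δ < volume.real K) {s t : ℝ} :
    IsFlotationChord K γ T δ s t ↔ ∃ θ, IsCapChord K γ T δ θ s t := by
  constructor
  · rintro ⟨hst, htT, θ, h, hw, hs, ht, harc⟩
    have hw' := hw
    rw [IsWaterSurface] at hw'
    obtain ⟨p, hp, hph⟩ := hK.exists_interior_level (θ := θ) (h := h) (by rwa [hw'])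
      (by rwa [hw'])
    have hc := isChord_of_arc hK hγ hp hst htT (hs.trans hph.symm) (ht.trans hph.symm)
      (by rwa [hph])
    refine ⟨θ, hc, ?_⟩
    rw [← hc.volume_underwater hK hγ, hs, hw']
  · rintro ⟨θ, hc⟩
    refine ⟨hc.1.lt, hc.1.lt_add, θ, _, hc.waterSurface hK hγ, rfl, hc.1.level.symm, ?_⟩
    intro u hu
    rcases eq_or_lt_of_le hu.1 with h | h
    · rw [h]
    rcases eq_or_lt_of_le hu.2 with h' | h'
    · rw [h', hc.1.level]
    exact (hc.1.arc_below hK hγ u ⟨h, h'⟩).le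

lemma exists_isCapChord (hK : IsConvexBody K) (hγ : IsC2BoundaryParam K γ T) (h0 : 0 < δ)
    (h1 : δ < volume.real K) (θ : ℝ) : ∃ s t, IsCapChord K γ T δ θ s t := by
  obtain ⟨h, hw⟩ := hK.exists_waterSurface h0 h1 θ
  rw [IsWaterSurface] at hw
  obtain ⟨p, hp, hph⟩ := hK.exists_interior_level (θ := θ) (h := h) (by rwa [hw]) (by rwa [hw])
  obtain ⟨s, t, hc, hl⟩ := exists_isChord hK hγ θ hp
  refine ⟨s, t, hc, ?_⟩
  rw [← hc.volume_underwater hK hγ, hl, hph, hw]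

lemma IsCapChord.unique (hK : IsConvexBody K) (hγ : IsC2BoundaryParam K γ T) (h0 : 0 < δ)
    (h1 : δ < volume.real K) {θ s t s' t' : ℝ} (hc : IsCapChord K γ T δ θ s t)
    (hc' : IsCapChord K γ T δ θ s' t') : ∃ k : ℤ, s' = s + k * T ∧ t' = t + k * T :=
  hc.1.unique hK hγ hc'.1
    (hK.waterSurface_unique h0 h1 (hc'.waterSurface hK hγ) (hc.waterSurface hK hγ))

/-- A quantity attached to a chord which does not change when the parameter is shifted by periods
is, for the chords of flotation, a function of the normal angle. -/
lemma exists_chordFunction {X : Type*} (hK : IsConvexBody K) (hγ : IsC2BoundaryParam K γ T)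
    (h0 : 0 < δ) (h1 : δ < volume.real K) (Q : ℝ → ℝ → ℝ → X)
    (hQ : ∀ θ s t, ∀ k : ℤ, Q θ (s + k * T) (t + k * T) = Q θ s t) :
    ∃ q : ℝ → X, ∀ θ s t, IsCapChord K γ T δ θ s t → q θ = Q θ s t := by
  choose s t hst using exists_isCapChord hK hγ h0 h1
  refine ⟨fun θ => Q θ (s θ) (t θ), fun θ s' t' hc => ?_⟩
  obtain ⟨k, rfl, rfl⟩ := (hst θ).unique hK hγ h0 h1 hc
  exact (hQ _ _ _ k).symm

lemma IsCapChord.exists_local (hγ : IsC2BoundaryParam K γ T) {θ₀ s₀ t₀ : ℝ}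
    (hc : IsCapChord K γ T δ θ₀ s₀ t₀) :
    ∃ S R : ℝ → ℝ, S θ₀ = s₀ ∧ R θ₀ = t₀ ∧
      HasDerivAt S (len γ θ₀ s₀ t₀ / (2 * -across γ θ₀ s₀)) θ₀ ∧
      HasDerivAt R (len γ θ₀ s₀ t₀ / (2 * across γ θ₀ t₀)) θ₀ ∧
      ∀ᶠ θ in nhds θ₀, IsCapChord K γ T δ θ (S θ) (R θ) := by
  obtain ⟨S, R, h1, h2, h3, h4, h5⟩ := hc.1.exists_local hγ
  refine ⟨S, R, h1, h2, h3, h4, ?_⟩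
  filter_upwards [h5] with θ hθ using ⟨hθ.1, hθ.2.trans hc.2⟩

/-! ### The chord condition -/

lemma ofReal_div_eq_iff {a b c d : ℝ} (ha : 0 < a) (hc : 0 < c) (hb : 0 ≤ b) (hd : 0 ≤ d) :
    ENNReal.ofReal a / ENNReal.ofReal b = ENNReal.ofReal c / ENNReal.ofReal d ↔
      a * d = c * b := by
  have top : ∀ {x : ℝ}, 0 < x → ENNReal.ofReal x / ENNReal.ofReal 0 = ⊤ := fun hx => by
    rw [ENNReal.ofReal_zero, ENNReal.div_zero (by simpa using hx)]
  rcases hb.eq_or_lt with rfl | hb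
  · rcases hd.eq_or_lt with rfl | hd
    · rw [top ha, top hc]; simp
    · rw [top ha, ← ENNReal.ofReal_div_of_pos hd, mul_zero]
      simp [ha.ne', hd.ne']
  · rcases hd.eq_or_lt with rfl | hd
    · rw [top hc, ← ENNReal.ofReal_div_of_pos hb, mul_zero]
      simp [hc.ne', hb.ne']
    · rw [← ENNReal.ofReal_div_of_pos hb, ← ENNReal.ofReal_div_of_pos hd,
        ENNReal.ofReal_eq_ofReal_iff (by positivity) (by positivity), div_eq_div_iff hb.ne' hd.ne']

/-- The affine curvature density `det(γ', γ'')` of the boundary curve. -/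
noncomputable def affDens (γ : ℝ → Plane) (u : ℝ) : ℝ := det (deriv γ u) (deriv (deriv γ) u)

lemma IsChord.norm_chord {θ s t : ℝ} (hc : IsChord K γ T θ s t) :
    ‖γ t - γ s‖ = len γ θ s t := by
  have h := norm_sq_frame θ (γ t - γ s)
  rw [inner_sub_left (γ t) (γ s) (dir θ), ← hc.level, sub_self] at h
  rw [← abs_of_pos (show 0 < len γ θ s t from hc.pos), ← abs_norm, ← sq_eq_sq_iff_abs_eq_abs, h,
    len]
  ring

lemma sin_angle_mul (x y : Plane) :
    Real.sin (InnerProductGeometry.angle x y) * (‖x‖ * ‖y‖) = |det x y| := by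
  rw [InnerProductGeometry.sin_angle_mul_norm_mul_norm, ← Real.sqrt_sq_eq_abs]
  congr 1
  simp only [inner_eq, det]
  ring

lemma IsChord.sin_chordAngle (hγ : IsC2BoundaryParam K γ T) {θ s t : ℝ}
    (hc : IsChord K γ T θ s t) (u : ℝ) :
    Real.sin (chordAngle γ s t u) = |across γ θ u| / ‖deriv γ u‖ := by
  have h := sin_angle_mul (γ t - γ s) (deriv γ u)
  have hl : 0 < len γ θ s t := hc.pos
  have hn : 0 < ‖deriv γ u‖ := norm_pos_iff.2 (hγ.regular u)
  rw [hc.det_chord, hc.norm_chord, abs_mul, abs_of_pos hl] at h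
  change Real.sin (chordAngle γ s t u) * _ = len γ θ s t * |across γ θ u| at h
  rw [eq_div_iff hn.ne']
  have : len γ θ s t * (Real.sin (chordAngle γ s t u) * ‖deriv γ u‖) =
      len γ θ s t * |across γ θ u| := by rw [← h]; ring
  exact mul_left_cancel₀ hl.ne' this

/-- With `sin α = a / |γ'|`, the speeds cancel against those in the curvature; the form without
quotients covers the case of vanishing curvature. -/
lemma IsChord.chordCondition_iff (hK : IsConvexBody K) (hγ : IsC2BoundaryParam K γ T)
    {θ s t : ℝ} (hc : IsChord K γ T θ s t) :
    ChordCondition γ s t ↔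
      affDens γ s * across γ θ t ^ 3 = affDens γ t * (-across γ θ s) ^ 3 := by
  have ha : 0 < -across γ θ s := neg_pos.2 (hc.deriv_left_neg hγ)
  have hb : 0 < across γ θ t := hc.deriv_right_pos hγ
  have hn : ∀ u, 0 < ‖deriv γ u‖ := fun u => norm_pos_iff.2 (hγ.regular u)
  have hns := hn s
  have hnt := hn t
  have hDs := hγ.det_nonneg hK s
  have hDt := hγ.det_nonneg hK t
  rw [ChordCondition, hc.sin_chordAngle hγ s, hc.sin_chordAngle hγ t, ← abs_neg (across γ θ s),
    abs_of_pos ha, abs_of_pos hb, curvature, curvature,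
    ofReal_div_eq_iff (by positivity) (by positivity) (by positivity) (by positivity)]
  rw [affDens, affDens, div_pow, div_pow, div_mul_div_comm, div_mul_div_comm,
    mul_comm (‖deriv γ t‖ ^ 3), div_left_inj' (by positivity)]
  constructor <;> intro h <;> linarith

/-! ### The affine length of the arcs cut off -/

lemma IsC2BoundaryParam.continuous_affDens (hγ : IsC2BoundaryParam K γ T) :
    Continuous (affDens γ) := by
  have := hγ.continuous_deriv
  have := hγ.continuous_deriv_deriv
  unfold affDens det; fun_prop

lemma IsC2BoundaryParam.continuous_affDens_rpow (hγ : IsC2BoundaryParam K γ T) :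
    Continuous fun u => affDens γ u ^ (1 / 3 : ℝ) :=
  hγ.continuous_affDens.rpow_const fun _ => Or.inr (by norm_num)

lemma affineArcLength_eq (s t : ℝ) :
    affineArcLength γ s t = ∫ u in s..t, affDens γ u ^ (1 / 3 : ℝ) := rfl

lemma IsC2BoundaryParam.affineArcLength_shift (hγ : IsC2BoundaryParam K γ T) (s t : ℝ) (k : ℤ) :
    affineArcLength γ (s + k * T) (t + k * T) = affineArcLength γ s t := by
  rw [affineArcLength_eq, affineArcLength_eq,
    ← intervalIntegral.integral_comp_add_right (fun u => affDens γ u ^ (1 / 3 : ℝ))]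
  have h1 : ∀ u, affDens γ (u + k * T) = affDens γ u := fun u => by
    rw [affDens, hγ.periodic_deriv.int_mul k u, hγ.periodic_deriv_deriv.int_mul k u, affDens]
  simp only [h1]

/-- The derivative of the affine length of the arc cut off vanishes exactly when the chord
condition holds. -/
lemma IsCapChord.affine_deriv (hK : IsConvexBody K) (hγ : IsC2BoundaryParam K γ T) {q : ℝ → ℝ}
    (hq : ∀ θ s t, IsCapChord K γ T δ θ s t → q θ = affineArcLength γ s t) {θ s t : ℝ}
    (hc : IsCapChord K γ T δ θ s t) :
    ∃ d, HasDerivAt q d θ ∧ (d = 0 ↔ ChordCondition γ s t) := by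
  obtain ⟨S, R, rfl, rfl, hS, hR, hloc⟩ := hc.exists_local hγ
  have hd := hasDerivAt_integral_moving hγ.continuous_affDens_rpow hS hR
  refine ⟨_, hd.congr_of_eventuallyEq ?_, ?_⟩
  · filter_upwards [hloc] with φ hφ
    rw [hq φ _ _ hφ, affineArcLength_eq]
  rw [hc.1.chordCondition_iff hK hγ]
  have ha : 0 < -across γ θ (S θ) := neg_pos.2 (hc.1.deriv_left_neg hγ)
  have hb : 0 < across γ θ (R θ) := hc.1.deriv_right_pos hγ
  have hl : 0 < len γ θ (S θ) (R θ) := hc.1.pos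
  set a := -across γ θ (S θ)
  set b := across γ θ (R θ)
  set l := len γ θ (S θ) (R θ)
  have root : ∀ u, 0 ≤ affDens γ u ^ (1 / 3 : ℝ) ∧
      (affDens γ u ^ (1 / 3 : ℝ)) ^ 3 = affDens γ u := fun u => by
    have hD : 0 ≤ affDens γ u := hγ.det_nonneg hK u
    refine ⟨Real.rpow_nonneg hD _, ?_⟩
    rw [← Real.rpow_natCast, ← Real.rpow_mul hD]
    norm_num
  obtain ⟨x0, x3⟩ := root (S θ)
  obtain ⟨y0, y3⟩ := root (R θ)
  set x := affDens γ (S θ) ^ (1 / 3 : ℝ)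
  set y := affDens γ (R θ) ^ (1 / 3 : ℝ)
  have key : affDens γ (S θ) * b ^ 3 = affDens γ (R θ) * a ^ 3 ↔ x * b = y * a := by
    rw [← x3, ← y3, ← mul_pow, ← mul_pow,
      pow_left_inj₀ (by positivity) (by positivity) (by norm_num)]
  rw [key]
  have e : y * (l / (2 * b)) - x * (l / (2 * a)) = l / (2 * a * b) * (y * a - x * b) := by
    field_simp
  rw [e, mul_eq_zero, sub_eq_zero]
  constructor
  · rintro (h | h)
    · exact absurd h (by positivity)
    · exact h.symm
  · intro h
    exact Or.inr h.symm

theorem chordCondition_iff_affineArcLength_const (hK : IsConvexBody K)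
    (hγ : IsC2BoundaryParam K γ T) (h0 : 0 < δ) (h1 : δ < volume.real K) :
    (∀ s t : ℝ, IsFlotationChord K γ T δ s t → ChordCondition γ s t) ↔
      ∃ L : ℝ, ∀ s t : ℝ, IsFlotationChord K γ T δ s t → affineArcLength γ s t = L := by
  obtain ⟨q, hq⟩ := exists_chordFunction hK hγ h0 h1 (fun _ s t => affineArcLength γ s t)
    (fun _ s t k => hγ.affineArcLength_shift s t k)
  simp only [isFlotationChord_iff hK hγ h0 h1]
  constructor
  · intro h
    have hd : ∀ θ, HasDerivAt q 0 θ := by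
      intro θ
      obtain ⟨s, t, hc⟩ := exists_isCapChord hK hγ h0 h1 θ
      obtain ⟨d, hd, hd0⟩ := hc.affine_deriv hK hγ hq
      rwa [hd0.2 (h s t ⟨θ, hc⟩)] at hd
    refine ⟨q 0, fun s t ⟨θ, hc⟩ => ?_⟩
    rw [← hq θ s t hc]
    exact is_const_of_deriv_eq_zero (fun θ => (hd θ).differentiableAt) (fun θ => (hd θ).deriv) θ 0
  · rintro ⟨L, hL⟩ s t ⟨θ, hc⟩
    obtain ⟨d, hd, hd0⟩ := hc.affine_deriv hK hγ hq
    have hqc : q = fun _ => L := by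
      ext φ
      obtain ⟨s', t', hc'⟩ := exists_isCapChord hK hγ h0 h1 φ
      rw [hq φ s' t' hc', hL s' t' ⟨φ, hc'⟩]
    rw [hqc] at hd
    exact hd0.1 (hd.unique (hasDerivAt_const θ L))

end

/-! ### The curves of flotation and of buoyancy -/

lemma hasDerivAt_plane {f : ℝ → Plane} {f' : Plane} {x : ℝ}
    (h : ∀ i, HasDerivAt (fun x => f x i) (f' i) x) : HasDerivAt f f' x :=
  ((PiLp.continuousLinearEquiv 2 ℝ fun _ : Fin 2 => ℝ).symm : (Fin 2 → ℝ) →L[ℝ] Plane).hasFDerivAt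
    |>.comp_hasDerivAt x (hasDerivAt_pi.2 h)

lemma hasDerivAt_dir (θ : ℝ) : HasDerivAt dir (-tangDir θ) θ := by
  refine hasDerivAt_plane fun i => ?_
  fin_cases i
  · simpa using Real.hasDerivAt_cos θ
  · simpa using Real.hasDerivAt_sin θ

lemma hasDerivAt_tangDir (θ : ℝ) : HasDerivAt tangDir (dir θ) θ := by
  refine hasDerivAt_plane fun i => ?_
  fin_cases i
  · simpa using Real.hasDerivAt_sin θ
  · simpa using (Real.hasDerivAt_cos θ).fun_neg

lemma dir_add_two_pi (θ : ℝ) : dir (θ + 2 * Real.pi) = dir θ := by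
  apply plane_ext <;> simp

section

variable {K : Set Plane} {γ : ℝ → Plane} {T δ : ℝ}

lemma IsC2BoundaryParam.hasDerivAt_along (hγ : IsC2BoundaryParam K γ T) {S : ℝ → ℝ} {s' θ : ℝ}
    (hS : HasDerivAt S s' θ) :
    HasDerivAt (fun φ => along γ φ (S φ))
      (across γ θ (S θ) + s' * inner ℝ (deriv (deriv γ) (S θ)) (tangDir θ)) θ := by
  have h := ((hγ.hasDerivAt_deriv (S θ)).scomp θ hS).inner ℝ (hasDerivAt_tangDir θ)
  simpa only [Function.comp_apply, real_inner_smul_left, along, across] using h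

lemma IsC2BoundaryParam.hasDerivAt_across (hγ : IsC2BoundaryParam K γ T) {S : ℝ → ℝ} {s' θ : ℝ}
    (hS : HasDerivAt S s' θ) :
    HasDerivAt (fun φ => across γ φ (S φ))
      (-along γ θ (S θ) + s' * inner ℝ (deriv (deriv γ) (S θ)) (dir θ)) θ := by
  have h := ((hγ.hasDerivAt_deriv (S θ)).scomp θ hS).inner ℝ (hasDerivAt_dir θ)
  simpa only [Function.comp_apply, real_inner_smul_left, inner_neg_right, along, across] using h

lemma IsChord.hasDerivAt_len (hγ : IsC2BoundaryParam K γ T) {S R : ℝ → ℝ} {s' r' θ : ℝ}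
    (hc : IsChord K γ T θ (S θ) (R θ)) (hS : HasDerivAt S s' θ) (hR : HasDerivAt R r' θ) :
    HasDerivAt (fun φ => len γ φ (S φ) (R φ))
      (r' * along γ θ (R θ) - s' * along γ θ (S θ)) θ := by
  have h := (((hγ.hasDerivAt (R θ)).scomp θ hR).sub ((hγ.hasDerivAt (S θ)).scomp θ hS)).inner ℝ
    (hasDerivAt_tangDir θ)
  refine h.congr_deriv ?_
  have hl := hc.level
  simp only [Function.comp_apply, Pi.sub_apply, inner_sub_left, real_inner_smul_left, along]
  linarith

/-- The signed speed with which the midpoint of the chord of flotation moves along the chord, when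
the normal angle is the time. -/
noncomputable def speed (γ : ℝ → Plane) (θ s t : ℝ) : ℝ :=
  len γ θ s t / 4 * (along γ θ s / -across γ θ s + along γ θ t / across γ θ t)

lemma IsCapChord.hasDerivAt_midpoint (hγ : IsC2BoundaryParam K γ T) {m : ℝ → Plane}
    (hm : ∀ θ s t, IsCapChord K γ T δ θ s t → m θ = (1 / 2 : ℝ) • (γ s + γ t)) {θ s t : ℝ}
    (hc : IsCapChord K γ T δ θ s t) : HasDerivAt m (speed γ θ s t • tangDir θ) θ := by
  obtain ⟨S, R, rfl, rfl, hS, hR, hloc⟩ := hc.exists_local hγ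
  have h := (((hγ.hasDerivAt (S θ)).scomp θ hS).add
    ((hγ.hasDerivAt (R θ)).scomp θ hR)).const_smul (1 / 2 : ℝ)
  refine (h.congr_of_eventuallyEq ?_).congr_deriv ?_
  · filter_upwards [hloc] with φ hφ using hm φ _ _ hφ
  have ha : across γ θ (S θ) ≠ 0 := (hc.1.deriv_left_neg hγ).ne
  have hb : across γ θ (R θ) ≠ 0 := (hc.1.deriv_right_pos hγ).ne'
  have e1 : deriv γ (S θ) = along γ θ (S θ) • tangDir θ + across γ θ (S θ) • dir θ :=
    frame_expand θ _
  have e2 : deriv γ (R θ) = along γ θ (R θ) • tangDir θ + across γ θ (R θ) • dir θ :=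
    frame_expand θ _
  rw [e1, e2, speed]
  match_scalars <;> field_simp <;> ring

/-- The midpoints of the chords of flotation trace the envelope of the water surfaces. -/
lemma flotationCurve_eq_range (hK : IsConvexBody K) (hγ : IsC2BoundaryParam K γ T) (h0 : 0 < δ)
    (h1 : δ < volume.real K) {m : ℝ → Plane}
    (hm : ∀ θ s t, IsCapChord K γ T δ θ s t → m θ = (1 / 2 : ℝ) • (γ s + γ t)) :
    (∀ θ, IsWaterSurface K δ θ (inner ℝ (m θ) (dir θ))) ∧
      flotationCurve K δ = Set.range m := by
  have hw : ∀ θ, IsWaterSurface K δ θ (inner ℝ (m θ) (dir θ)) := by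
    intro θ
    obtain ⟨s, t, hc⟩ := exists_isCapChord hK hγ h0 h1 θ
    rw [hm θ s t hc, hc.1.mid_level]
    exact hc.waterSurface hK hγ
  have hder : ∀ (x : Plane) θ, HasDerivAt (fun φ => inner ℝ x (dir φ) - inner ℝ (m φ) (dir φ))
      (inner ℝ (m θ) (tangDir θ) - inner ℝ x (tangDir θ)) θ := by
    intro x θ
    obtain ⟨s, t, hc⟩ := exists_isCapChord hK hγ h0 h1 θ
    have h := ((hasDerivAt_const θ x).inner ℝ (hasDerivAt_dir θ)).sub
      ((hc.hasDerivAt_midpoint hγ hm).inner ℝ (hasDerivAt_dir θ))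
    refine h.congr_deriv ?_
    rw [inner_neg_right, inner_neg_right, inner_zero_left, real_inner_smul_left,
      inner_tangDir_dir, sub_self, Real.sin_zero]
    ring
  refine ⟨hw, Set.Subset.antisymm ?_ ?_⟩
  · rintro x ⟨h, hh, θ, hF, hd⟩
    have hhm : h = fun θ => inner ℝ (m θ) (dir θ) :=
      funext fun θ => hK.waterSurface_unique h0 h1 (hh θ) (hw θ)
    subst hhm
    exact ⟨θ, frame_ext θ (sub_eq_zero.1 ((hder x θ).unique hd)) (sub_eq_zero.1 hF).symm⟩
  · rintro _ ⟨θ, rfl⟩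
    exact ⟨_, hw, θ, sub_self _, by simpa using hder (m θ) θ⟩

/-- The centroid of the underwater part moves parallel to the water surface, with speed
`len³ / (12 δ)`. -/
lemma exists_buoyancy (hK : IsConvexBody K) (hγ : IsC2BoundaryParam K γ T) (h0 : 0 < δ)
    (h1 : δ < volume.real K) :
    ∃ G : ℝ → Plane, buoyancyCurve K δ = Set.range G ∧ (∀ θ, G (θ + 2 * Real.pi) = G θ) ∧
      ∀ θ s t, IsCapChord K γ T δ θ s t →
        HasDerivAt G ((len γ θ s t ^ 3 / (12 * δ)) • tangDir θ) θ := by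
  choose h hh using hK.exists_waterSurface h0 h1
  refine ⟨fun θ => ⨍ y in underwater K θ (h θ), y, ?_, ?_, ?_⟩
  · refine Set.Subset.antisymm ?_ ?_
    · rintro x ⟨θ, h', hw, rfl⟩
      refine ⟨θ, ?_⟩
      rw [hK.waterSurface_unique h0 h1 hw (hh θ)]
    · rintro _ ⟨θ, rfl⟩
      exact ⟨θ, h θ, hh θ, rfl⟩
  · intro θ
    have e : ∀ h', underwater K (θ + 2 * Real.pi) h' = underwater K θ h' := fun h' => by
      simp only [underwater, dir_add_two_pi]
    have : h (θ + 2 * Real.pi) = h θ := by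
      refine hK.waterSurface_unique h0 h1 (θ := θ) ?_ (hh θ)
      have := hh (θ + 2 * Real.pi)
      rwa [IsWaterSurface, e] at this
    simp only [this, e]
  · intro θ s t hc
    have hval : ∀ φ s t, IsCapChord K γ T δ φ s t → ∀ i,
        (⨍ y in underwater K φ (h φ), y) i = δ⁻¹ * capMoment γ i s t := by
      intro φ s t hc i
      have hw := hc.waterSurface hK hγ
      rw [hK.waterSurface_unique h0 h1 (hh φ) hw, setAverage_eq, hw, PiLp.smul_apply, smul_eq_mul,
        ← hc.1.moment_underwater hK hγ i, eval_integral_piLp]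
      intro j
      have hcomp : IsCompact (underwater K φ (inner ℝ (γ s) (dir φ))) :=
        hK.compact.of_isClosed_subset (hK.isClosed_underwater _ _) (underwater_subset _ _)
      exact ContinuousOn.integrableOn_compact hcomp (by fun_prop)
    obtain ⟨S, R, rfl, rfl, hS, hR, hloc⟩ := hc.exists_local hγ
    refine hasDerivAt_plane fun i => ?_
    have hd := (hγ.hasDerivAt_capMoment hS hR i).const_mul δ⁻¹
    refine (hd.congr_of_eventuallyEq ?_).congr_deriv ?_
    · filter_upwards [hloc] with φ hφ using hval φ _ _ hφ i
    have ha : across γ θ (S θ) ≠ 0 := (hc.1.deriv_left_neg hγ).ne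
    have hb : across γ θ (R θ) ≠ 0 := (hc.1.deriv_right_pos hγ).ne'
    have hlc : γ (R θ) i - γ (S θ) i = len γ θ (S θ) (R θ) * tangDir θ i := by
      have h2 := frame_expand θ (γ (R θ) - γ (S θ))
      rw [inner_sub_left (γ (R θ)) (γ (S θ)) (dir θ), ← hc.1.level, sub_self, zero_smul,
        add_zero] at h2
      have h3 := congrArg (fun v : Plane => v i) h2
      simpa only [PiLp.sub_apply, PiLp.smul_apply, smul_eq_mul, len] using h3
    rw [hc.1.det_chord, hc.1.det_chord]
    change δ⁻¹ * (len γ θ (S θ) (R θ) * across γ θ (S θ) * _ * _ +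
      len γ θ (S θ) (R θ) * across γ θ (R θ) * _ * _) = len γ θ (S θ) (R θ) ^ 3 / (12 * δ) *
        tangDir θ i
    set l := len γ θ (S θ) (R θ)
    have h0' := h0.ne'
    field_simp
    linear_combination 36 * l ^ 2 * hlc

/-! ### Homothetic curves have proportional radii of curvature -/

/-- A closed curve with velocity `R θ • tangDir θ`, `R > 0`, bounds a strictly convex region: the
point with parameter `c` is the lowest one in the direction `dir c`, and not the highest. -/
lemma lowest_point {G : ℝ → Plane} {R : ℝ → ℝ} (hG : ∀ θ, HasDerivAt G (R θ • tangDir θ) θ)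
    (hR : ∀ θ, 0 < R θ) (hper : ∀ θ, G (θ + 2 * Real.pi) = G θ) (c : ℝ) :
    (∀ φ, inner ℝ (G c) (dir c) ≤ inner ℝ (G φ) (dir c)) ∧
      inner ℝ (G c) (dir c) < inner ℝ (G (c + Real.pi)) (dir c) := by
  have hπ := Real.pi_pos
  have hd : ∀ φ, HasDerivAt (fun φ => inner ℝ (G φ) (dir c)) (R φ * Real.sin (φ - c)) φ := by
    intro φ
    have h := (hG φ).inner ℝ (hasDerivAt_const φ (dir c))
    simpa [real_inner_smul_left, inner_tangDir_dir] using h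
  have hcont : Continuous fun φ => inner ℝ (G φ) (dir c) :=
    continuous_iff_continuousAt.2 fun φ => (hd φ).continuousAt
  have hmono : StrictMonoOn (fun φ => inner ℝ (G φ) (dir c)) (Set.Icc c (c + Real.pi)) := by
    refine strictMonoOn_of_deriv_pos (convex_Icc _ _) hcont.continuousOn fun φ hφ => ?_
    rw [interior_Icc] at hφ
    rw [(hd φ).deriv]
    exact mul_pos (hR φ) (Real.sin_pos_of_pos_of_lt_pi (by linarith [hφ.1]) (by linarith [hφ.2]))
  have hanti : StrictAntiOn (fun φ => inner ℝ (G φ) (dir c)) (Set.Icc (c - Real.pi) c) := by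
    refine strictAntiOn_of_deriv_neg (convex_Icc _ _) hcont.continuousOn fun φ hφ => ?_
    rw [interior_Icc] at hφ
    rw [(hd φ).deriv]
    exact mul_neg_of_pos_of_neg (hR φ)
      (Real.sin_neg_of_neg_of_neg_pi_lt (by linarith [hφ.2]) (by linarith [hφ.1]))
  refine ⟨fun φ => ?_, hmono ⟨le_rfl, by linarith⟩ ⟨by linarith, le_rfl⟩ (by linarith)⟩
  have hperG : Function.Periodic G (2 * Real.pi) := hper
  obtain ⟨ψ, hψ, hGψ⟩ := hperG.exists_mem_Ico (by positivity) φ (c - Real.pi)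
  rw [hGψ]
  rcases le_total ψ c with h | h
  · exact hanti.antitoneOn ⟨hψ.1, h⟩ ⟨by linarith, le_rfl⟩ h
  · exact hmono.monotoneOn ⟨le_rfl, by linarith⟩ ⟨h, by linarith [hψ.2]⟩ h

/-- If two closed curves have parallel tangents at equal parameters, the second one is strictly
convex, and a dilation with ratio `r` maps the first onto the second, then their radii of curvature
are proportional, possibly after a half turn. No assumption is made on how the parameters
correspond under the dilation; the set where the first curve has nonzero speed is open and closed,
because there its speed is one of the two radii of curvature of the second curve. -/
lemma speed_dichotomy {m G : ℝ → Plane} {ρ R : ℝ → ℝ} {r : ℝ}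
    (hm : ∀ θ, HasDerivAt m (ρ θ • tangDir θ) θ) (hG : ∀ θ, HasDerivAt G (R θ • tangDir θ) θ)
    (hρc : Continuous ρ) (hRc : Continuous R) (hR : ∀ θ, 0 < R θ)
    (hper : ∀ θ, G (θ + 2 * Real.pi) = G θ)
    (hhom : HomotheticWithRatio (Set.range m) (Set.range G) r) :
    (∀ θ, r * ρ θ = R θ) ∨ (∀ θ, r * ρ θ = -R (θ + Real.pi)) := by
  obtain ⟨p, hp⟩ := hhom
  set f : ℝ → Plane := fun θ => r • (m θ - p) + p with hf
  have hfm : ∀ θ, AffineMap.homothety p r (m θ) = f θ := fun θ => by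
    simp [hf, AffineMap.homothety_apply]
  have hfd : ∀ θ, HasDerivAt f ((r * ρ θ) • tangDir θ) θ := fun θ => by
    have h := (((hm θ).sub_const p).const_smul r).add_const p
    rwa [smul_smul] at h
  have hfG : ∀ θ, ∃ c, f θ = G c := fun θ => by
    have : f θ ∈ Set.range G := by
      rw [← hp, ← hfm]; exact Set.mem_image_of_mem _ (Set.mem_range_self θ)
    obtain ⟨c, hc⟩ := this
    exact ⟨c, hc.symm⟩
  have hfc : Continuous f := continuous_iff_continuousAt.2 fun θ => (hfd θ).continuousAt
  have hGc : Continuous G := continuous_iff_continuousAt.2 fun θ => (hG θ).continuousAt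
  have hperG : Function.Periodic G (2 * Real.pi) := hper
  have hGne : ∀ θ, G θ ≠ G (θ + Real.pi) := fun θ h => by
    have := (lowest_point hG hR hper θ).2
    rw [← h] at this
    exact this.false
  have hGπd : ∀ θ, HasDerivAt (fun θ => G (θ + Real.pi)) (-R (θ + Real.pi) • tangDir θ) θ := by
    intro θ
    have h := (hG (θ + Real.pi)).comp_add_const θ Real.pi
    rwa [tangDir_add_pi, smul_neg, ← neg_smul] at h
  have hAcl : IsClosed {θ | f θ = G θ} := isClosed_eq hfc hGc
  have hBcl : IsClosed {θ | f θ = G (θ + Real.pi)} := isClosed_eq hfc (by fun_prop)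
  -- the image lies above the tangent of the second curve at a common point, so the tangents agree
  have hAB : ∀ θ, r * ρ θ ≠ 0 → f θ = G θ ∨ f θ = G (θ + Real.pi) := by
    intro θ hne
    obtain ⟨c, hc⟩ := hfG θ
    have hmin : IsLocalMin (fun φ => inner ℝ (f φ) (dir c)) θ := by
      refine Filter.Eventually.of_forall fun φ => ?_
      obtain ⟨c', hc'⟩ := hfG φ
      simp only [hc, hc']
      exact (lowest_point hG hR hper c).1 c'
    have h := hmin.hasDerivAt_eq_zero ((hfd θ).inner ℝ (hasDerivAt_const θ (dir c)))
    rw [inner_zero_right, zero_add, real_inner_smul_left, inner_tangDir_dir, mul_eq_zero] at h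
    obtain ⟨n, hn⟩ := Real.sin_eq_zero_iff.1 (h.resolve_left hne)
    obtain ⟨k, hk | hk⟩ := Int.even_or_odd' n
    · left
      rw [hc, ← hperG.int_mul k c]
      congr 1
      rw [hk] at hn; push_cast at hn; linarith
    · right
      rw [hc, ← hperG.int_mul (k + 1) c]
      congr 1
      rw [hk] at hn; push_cast at hn ⊢; linarith
  have hρA : ∀ θ, f θ = G θ → r * ρ θ ≠ 0 → r * ρ θ = R θ := by
    intro θ hA hne
    have hev : f =ᶠ[nhds θ] G := by
      have h1 : ∀ᶠ φ in nhds θ, f φ ≠ G (φ + Real.pi) :=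
        hBcl.isOpen_compl.mem_nhds (fun h => hGne θ (hA.symm.trans h))
      have h2 : ∀ᶠ φ in nhds θ, r * ρ φ ≠ 0 :=
        (continuous_const.mul hρc).continuousAt.eventually_ne hne
      filter_upwards [h1, h2] with φ h1 h2 using (hAB φ h2).resolve_right h1
    have := (hfd θ).unique ((hG θ).congr_of_eventuallyEq hev)
    exact smul_left_injective ℝ (tangDir_ne_zero θ) this
  have hρB : ∀ θ, f θ = G (θ + Real.pi) → r * ρ θ ≠ 0 → r * ρ θ = -R (θ + Real.pi) := by
    intro θ hB hne
    have hev : f =ᶠ[nhds θ] fun φ => G (φ + Real.pi) := by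
      have h1 : ∀ᶠ φ in nhds θ, f φ ≠ G φ :=
        hAcl.isOpen_compl.mem_nhds (fun h => hGne θ (Eq.trans (Eq.symm h) hB))
      have h2 : ∀ᶠ φ in nhds θ, r * ρ φ ≠ 0 :=
        (continuous_const.mul hρc).continuousAt.eventually_ne hne
      filter_upwards [h1, h2] with φ h1 h2 using (hAB φ h2).resolve_left h1
    have := (hfd θ).unique ((hGπd θ).congr_of_eventuallyEq hev)
    exact smul_left_injective ℝ (tangDir_ne_zero θ) this
  have hUeq : {θ | r * ρ θ ≠ 0} = {θ | r * ρ θ = R θ} ∪ {θ | r * ρ θ = -R (θ + Real.pi)} := by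
    ext θ
    constructor
    · intro h
      exact (hAB θ h).imp (fun hA => hρA θ hA h) fun hB => hρB θ hB h
    · rintro (h | h) h'
      · exact (hR θ).ne' (Eq.trans (Eq.symm h) h')
      · exact (neg_neg_of_pos (hR (θ + Real.pi))).ne (Eq.trans (Eq.symm h) h')
  have hUclopen : IsClopen {θ | r * ρ θ ≠ 0} := by
    refine ⟨?_, isOpen_ne_fun (by fun_prop) continuous_const⟩
    rw [hUeq]
    exact (isClosed_eq (by fun_prop) hRc).union (isClosed_eq (by fun_prop) (by fun_prop))
  have hne : ∀ θ, r * ρ θ ≠ 0 := by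
    rcases isClopen_iff.1 hUclopen with h | h
    · exfalso
      have hconst : ∀ θ θ', f θ = f θ' := by
        have hz : ∀ θ, r * ρ θ = 0 := fun θ => by
          by_contra hne
          exact (Set.eq_empty_iff_forall_notMem.1 h θ) hne
        refine is_const_of_deriv_eq_zero (fun θ => (hfd θ).differentiableAt) fun θ => ?_
        rw [(hfd θ).deriv, hz, zero_smul]
      have hGf : ∀ c, ∃ θ, f θ = G c := fun c => by
        have : G c ∈ AffineMap.homothety p r '' Set.range m := hp ▸ Set.mem_range_self c
        obtain ⟨_, ⟨θ, rfl⟩, hθ⟩ := this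
        exact ⟨θ, by rw [← hfm, hθ]⟩
      obtain ⟨θ, hθ⟩ := hGf 0
      obtain ⟨θ', hθ'⟩ := hGf (0 + Real.pi)
      exact hGne 0 (by rw [← hθ, ← hθ', hconst θ θ'])
    · intro θ
      exact (Set.eq_univ_iff_forall.1 h θ)
  have hA' : IsClopen {θ | f θ = G θ} := by
    refine ⟨hAcl, ?_⟩
    have : {θ | f θ = G θ} = {θ | f θ = G (θ + Real.pi)}ᶜ := by
      ext θ
      exact ⟨fun h h' => hGne θ (Eq.trans (Eq.symm h) h'),
        fun h => (hAB θ (hne θ)).resolve_right h⟩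
    rw [this]
    exact hBcl.isOpen_compl
  rcases isClopen_iff.1 hA' with h | h
  · right
    intro θ
    exact hρB θ ((hAB θ (hne θ)).resolve_left (Set.eq_empty_iff_forall_notMem.1 h θ)) (hne θ)
  · left
    intro θ
    exact hρA θ (Set.eq_univ_iff_forall.1 h θ) (hne θ)

end

/-! ### Homothety implies the chord condition -/

section

variable {K : Set Plane} {γ : ℝ → Plane} {T δ : ℝ}

lemma IsC2BoundaryParam.len_shift (hγ : IsC2BoundaryParam K γ T) (θ s t : ℝ) (k : ℤ) :
    len γ θ (s + k * T) (t + k * T) = len γ θ s t := by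
  simp only [len, hγ.periodic.int_mul k s, hγ.periodic.int_mul k t]

/-- If the speed of the midpoint is proportional to the cube of the length of the chord, then
the chord condition is the derivative of this relation. -/
lemma IsCapChord.chordCondition_of_speed (hK : IsConvexBody K) (hγ : IsC2BoundaryParam K γ T)
    {c : ℝ} (hc0 : c ≠ 0)
    (hsp : ∀ θ s t, IsCapChord K γ T δ θ s t → c * speed γ θ s t = len γ θ s t ^ 3) {θ s t : ℝ}
    (hc : IsCapChord K γ T δ θ s t) : ChordCondition γ s t := by
  obtain ⟨S, R, rfl, rfl, hS, hR, hloc⟩ := hc.exists_local hγ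
  rw [hc.1.chordCondition_iff hK hγ]
  have ha : 0 < -across γ θ (S θ) := neg_pos.2 (hc.1.deriv_left_neg hγ)
  have hb : 0 < across γ θ (R θ) := hc.1.deriv_right_pos hγ
  have hl : 0 < len γ θ (S θ) (R θ) := hc.1.pos
  have h1 := (((hγ.hasDerivAt_along hS).div (hγ.hasDerivAt_across hS).fun_neg ha.ne').add
    ((hγ.hasDerivAt_along hR).div (hγ.hasDerivAt_across hR) hb.ne')).const_mul c
  have h2 := ((hc.1.hasDerivAt_len hγ hS hR).pow 2).const_mul 4
  have rel : ∀ φ s t, IsCapChord K γ T δ φ s t →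
      c * (along γ φ s / -across γ φ s + along γ φ t / across γ φ t) = 4 * len γ φ s t ^ 2 := by
    intro φ s t hφ
    have hl : 0 < len γ φ s t := hφ.1.pos
    have := hsp φ s t hφ
    rw [speed] at this
    have h3 : len γ φ s t * (c * (along γ φ s / -across γ φ s + along γ φ t / across γ φ t)) =
        len γ φ s t * (4 * len γ φ s t ^ 2) := by linear_combination 4 * this
    exact mul_left_cancel₀ hl.ne' h3
  have h3 := h1.unique (h2.congr_of_eventuallyEq (by
    filter_upwards [hloc] with φ hφ using rel φ _ _ hφ))
  have h4 := rel θ _ _ hc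
  have hDs : affDens γ (S θ) = _ := det_frame θ _ _
  have hDt : affDens γ (R θ) = _ := det_frame θ _ _
  rw [hDs, hDt]
  change (along γ θ (S θ) * _ - across γ θ (S θ) * _) * _ =
    (along γ θ (R θ) * _ - across γ θ (R θ) * _) * _
  generalize inner ℝ (deriv (deriv γ) (S θ)) (tangDir θ) = s1 at *
  generalize inner ℝ (deriv (deriv γ) (S θ)) (dir θ) = s2 at *
  generalize inner ℝ (deriv (deriv γ) (R θ)) (tangDir θ) = r1 at *
  generalize inner ℝ (deriv (deriv γ) (R θ)) (dir θ) = r2 at *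
  obtain ⟨a, hae⟩ : ∃ a, a = -across γ θ (S θ) := ⟨_, rfl⟩
  have hae' : across γ θ (S θ) = -a := by rw [hae, neg_neg]
  simp only [hae', neg_neg] at *
  generalize along γ θ (S θ) = p at *
  generalize along γ θ (R θ) = q at *
  generalize across γ θ (R θ) = b at *
  generalize len γ θ (S θ) (R θ) = l at *
  clear hS hR h1 h2 hloc rel hsp hc hDs hDt
  -- in terms of `X = p / a`, `Y = q / b` this is `c (X + Y)' = 4 (l²)'`, where `l' = l (Y - X) / 2`
  have e1 : c * ((l * (p * s2 + a * s1) / (2 * a ^ 3) - 1 - (p / a) ^ 2) +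
      (1 + (q / b) ^ 2 - l * (q * r2 - b * r1) / (2 * b ^ 3))) =
      4 * l ^ 2 * (q / b - p / a) := by
    have e2 : 4 * l ^ 2 * (q / b - p / a) =
        4 * (((2 : ℕ) : ℝ) * l ^ (2 - 1) * (l / (2 * b) * q - l / (2 * a) * p)) := by
      push_cast; field_simp
    rw [e2, ← h3]
    field_simp
    ring
  -- by `c (X + Y) = 4 l²` the right side is `c (Y² - X²)`, which cancels against the left side
  rw [← h4] at e1
  have e3 : c * l * ((p * s2 + a * s1) * b ^ 3 - (q * r2 - b * r1) * a ^ 3) = 0 := by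
    have : c * l * ((p * s2 + a * s1) * b ^ 3 - (q * r2 - b * r1) * a ^ 3) = 2 * a ^ 3 * b ^ 3 *
      (c * ((l * (p * s2 + a * s1) / (2 * a ^ 3) - 1 - (p / a) ^ 2) +
      (1 + (q / b) ^ 2 - l * (q * r2 - b * r1) / (2 * b ^ 3))) -
      c * (p / a + q / b) * (q / b - p / a)) := by
      field_simp
      ring
    rw [this, e1]; ring
  have := (mul_eq_zero.1 e3).resolve_left (mul_ne_zero hc0 hl.ne')
  linarith

/-- The underwater parts for two opposite directions are disjoint, share just the water surface, or
overlap in a strip, according to whether less than half, half, or more than half of the body is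
under water; `h θ + h (θ + π)` is the signed width of the strip. -/
lemma level_add_pi_nonpos (hK : IsConvexBody K) (h0 : 0 < δ) (h1 : δ < volume.real K) {h : ℝ → ℝ}
    (hh : ∀ θ, IsWaterSurface K δ θ (h θ)) {r : ℝ} (hr1 : δ < volume.real K / 2 → 0 < r)
    (hr2 : volume.real K / 2 < δ → r < 0) (θ : ℝ) : r * (h θ + h (θ + Real.pi)) ≤ 0 := by
  have hw1 : volume.real (underwater K (θ + Real.pi) (-h θ)) = volume.real K - δ := by
    rw [hK.underwater_add_pi, hh θ]
  have hw2 : volume.real (underwater K (θ + Real.pi) (h (θ + Real.pi))) = δ := hh (θ + Real.pi)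
  rcases lt_trichotomy δ (volume.real K / 2) with hlt | heq | hgt
  · refine mul_nonpos_of_nonneg_of_nonpos (hr1 hlt).le ?_
    by_contra! hcon
    have := hK.underwater_mono (θ + Real.pi) (h := -h θ) (h' := h (θ + Real.pi)) (by linarith)
    linarith
  · have : IsWaterSurface K δ (θ + Real.pi) (-h θ) := by rw [IsWaterSurface, hw1]; linarith
    have := hK.waterSurface_unique h0 h1 (hh (θ + Real.pi)) this
    rw [this]; simp
  · refine mul_nonpos_of_nonpos_of_nonneg (hr2 hgt).le ?_
    by_contra! hcon
    have := hK.underwater_mono (θ + Real.pi) (h := h (θ + Real.pi)) (h' := -h θ) (by linarith)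
    linarith

/-- The envelope `m` of the oriented lines with levels `m θ · dir θ` cannot have everywhere
negative speed if `r` times the sum of the levels of opposite lines is nonpositive:
the function `m θ · tangDir θ`, symmetrized under the half turn, would be periodic and strictly
monotone. -/
lemma not_forall_speed_neg {m : ℝ → Plane} {ρ : ℝ → ℝ} {r : ℝ}
    (hm : ∀ θ, HasDerivAt m (ρ θ • tangDir θ) θ) (hper : ∀ θ, m (θ + 2 * Real.pi) = m θ)
    (hlev : ∀ θ, r * (inner ℝ (m θ) (dir θ) +
      inner ℝ (m (θ + Real.pi)) (dir (θ + Real.pi))) ≤ 0) : ¬ ∀ θ, r * ρ θ < 0 := by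
  intro hneg
  set H : ℝ → ℝ := fun θ => inner ℝ (m θ) (tangDir θ) with hH
  have hHd : ∀ θ, HasDerivAt H (inner ℝ (m θ) (dir θ) + ρ θ) θ := by
    intro θ
    have h := (hm θ).inner ℝ (hasDerivAt_tangDir θ)
    rwa [real_inner_smul_left, inner_tangDir_self, mul_one] at h
  have hJd : ∀ θ, HasDerivAt (fun θ => r * (H θ + H (θ + Real.pi))) _ θ := fun θ =>
    ((hHd θ).add ((hHd (θ + Real.pi)).comp_add_const θ Real.pi)).const_mul r
  have hanti : StrictAnti fun θ => r * (H θ + H (θ + Real.pi)) := by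
    refine strictAnti_of_deriv_neg fun θ => ?_
    rw [(hJd θ).deriv]
    have h1 := hlev θ
    have h2 := hneg θ
    have h3 := hneg (θ + Real.pi)
    linarith
  have h := hanti (show (0 : ℝ) < 0 + Real.pi by linarith [Real.pi_pos])
  have hH2 : H (0 + Real.pi + Real.pi) = H 0 := by
    have e : (0 : ℝ) + Real.pi + Real.pi = 0 + 2 * Real.pi := by ring
    simp only [hH, e, hper]
    congr 1
    apply plane_ext <;> simp
  simp only [hH2] at h
  linarith

theorem chordCondition_of_homothetic (hK : IsConvexBody K) (hγ : IsC2BoundaryParam K γ T)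
    (h0 : 0 < δ) (h1 : δ < volume.real K) (hhom : FlotationHomotheticToBuoyancy K δ) (s t : ℝ)
    (hc : IsFlotationChord K γ T δ s t) : ChordCondition γ s t := by
  obtain ⟨r, hr0, hr1, hr2, hhom⟩ := hhom
  obtain ⟨m, hm⟩ := exists_chordFunction hK hγ h0 h1
    (fun _ s t => (1 / 2 : ℝ) • (γ s + γ t)) fun _ s t k => by
      rw [hγ.periodic.int_mul k s, hγ.periodic.int_mul k t]
  obtain ⟨l, hl⟩ := exists_chordFunction hK hγ h0 h1 (fun θ s t => len γ θ s t)
    hγ.len_shift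
  obtain ⟨ρ, hρ⟩ := exists_chordFunction hK hγ h0 h1 (fun θ s t => speed γ θ s t)
    fun θ s t k => by
      simp only [speed, hγ.len_shift, along, across, hγ.periodic_deriv.int_mul k s,
        hγ.periodic_deriv.int_mul k t]
  obtain ⟨hw, hfl⟩ := flotationCurve_eq_range hK hγ h0 h1 hm
  obtain ⟨G, hbu, hGper, hG⟩ := exists_buoyancy hK hγ h0 h1
  have hch := exists_isCapChord hK hγ h0 h1
  have hmd : ∀ θ, HasDerivAt m (ρ θ • tangDir θ) θ := fun θ => by
    obtain ⟨s, t, hc⟩ := hch θ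
    rw [hρ θ s t hc]
    exact hc.hasDerivAt_midpoint hγ hm
  have hGd : ∀ θ, HasDerivAt G ((l θ ^ 3 / (12 * δ)) • tangDir θ) θ := fun θ => by
    obtain ⟨s, t, hc⟩ := hch θ
    rw [hl θ s t hc]
    exact hG θ s t hc
  have hl0 : ∀ θ, 0 < l θ := fun θ => by
    obtain ⟨s, t, hc⟩ := hch θ
    rw [hl θ s t hc]
    exact hc.1.pos
  have hlc : Continuous l := continuous_iff_continuousAt.2 fun θ => by
    obtain ⟨s, t, hc⟩ := hch θ
    obtain ⟨S, R, rfl, rfl, hS, hR, hloc⟩ := hc.exists_local hγ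
    refine (hc.1.hasDerivAt_len hγ hS hR).continuousAt.congr ?_
    filter_upwards [hloc] with φ hφ using (hl φ _ _ hφ).symm
  have hρc : Continuous ρ := continuous_iff_continuousAt.2 fun θ => by
    obtain ⟨s, t, hc⟩ := hch θ
    obtain ⟨S, R, rfl, rfl, hS, hR, hloc⟩ := hc.exists_local hγ
    have ha : -across γ θ (S θ) ≠ 0 := neg_ne_zero.2 (hc.1.deriv_left_neg hγ).ne
    have hb : across γ θ (R θ) ≠ 0 := (hc.1.deriv_right_pos hγ).ne'
    have hcont : ContinuousAt (fun φ => speed γ φ (S φ) (R φ)) θ :=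
      ((hc.1.hasDerivAt_len hγ hS hR).continuousAt.div_const 4).mul
        (((hγ.hasDerivAt_along hS).continuousAt.div
          (hγ.hasDerivAt_across hS).continuousAt.neg ha).add
        ((hγ.hasDerivAt_along hR).continuousAt.div (hγ.hasDerivAt_across hR).continuousAt hb))
    refine hcont.congr ?_
    filter_upwards [hloc] with φ hφ using (hρ φ _ _ hφ).symm
  have hR : ∀ θ, 0 < l θ ^ 3 / (12 * δ) := fun θ => by
    have := hl0 θ
    positivity
  rw [hfl, hbu] at hhom
  rcases speed_dichotomy hmd hGd hρc (by fun_prop) hR hGper hhom with hA | hB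
  · obtain ⟨θ, hc⟩ := (isFlotationChord_iff hK hγ h0 h1).1 hc
    refine hc.chordCondition_of_speed hK hγ (c := 12 * δ * r)
      (mul_ne_zero (by positivity) hr0) fun φ s t hφ => ?_
    have := hA φ
    rw [hρ φ s t hφ, hl φ s t hφ, eq_div_iff (by positivity)] at this
    linarith
  · exfalso
    have hmper : ∀ θ, m (θ + 2 * Real.pi) = m θ := fun θ => by
      obtain ⟨s, t, hc⟩ := hch θ
      have hc' : IsCapChord K γ T δ (θ + 2 * Real.pi) s t := by
        have e : tangDir (θ + 2 * Real.pi) = tangDir θ := by apply plane_ext <;> simp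
        refine ⟨⟨hc.1.lt, hc.1.lt_add, ?_, ?_, hc.1.mid⟩, hc.2⟩
        · rw [dir_add_two_pi]; exact hc.1.level
        · rw [e]; exact hc.1.pos
      rw [hm _ s t hc', hm _ s t hc]
    refine not_forall_speed_neg (r := r) hmd hmper
      (level_add_pi_nonpos hK h0 h1 hw hr1 hr2) fun θ => ?_
    rw [hB θ]
    exact neg_neg_of_pos (hR _)

end

end Flotation

theorem mainTheorem2 (K : Set Flotation.Plane) (hK : Flotation.IsConvexBody K)
    (γ : ℝ → Flotation.Plane) (T : ℝ) (hγ : Flotation.IsC2BoundaryParam K γ T)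
    (δ : ℝ) (hδ_pos : 0 < δ) (hδ_lt : δ < MeasureTheory.volume.real K) :
    (Flotation.FlotationHomotheticToBuoyancy K δ →
      ∀ s t : ℝ, Flotation.IsFlotationChord K γ T δ s t → Flotation.ChordCondition γ s t) ∧
    ((∀ s t : ℝ, Flotation.IsFlotationChord K γ T δ s t → Flotation.ChordCondition γ s t) ↔
      ∃ L : ℝ, ∀ s t : ℝ, Flotation.IsFlotationChord K γ T δ s t →
        Flotation.affineArcLength γ s t = L) :=
  ⟨Flotation.chordCondition_of_homothetic hK hγ hδ_pos hδ_lt,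
    Flotation.chordCondition_iff_affineArcLength_const hK hγ hδ_pos hδ_lt⟩
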